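/- **Setting.** There are $N\ge 1$ players. A product has value $V\in\{-1,1\}$ with $\Pr(V=\pm1)=\tfrac12$; given $V$, the players' private signals $X^n\in\{-1,1\}$ are independent with $\Pr(X^n=V)=1-p$, where $p\in(0,\tfrac12)$. At each turn $t=0,1,2,\dots$ a player $n_t$ is drawn uniformly and independently; if she has not bought before she may buy ($1$) or wait ($0$), and all other players play $0$. Actions and identities are public, and a player who buys obtains $V$. The total reward is discounted by $\delta$. A perfect Bayesian equilibrium (PBE) consists of pure strategies and of private beliefs on $(X^{-n},V)$ at every information set (also off the equilibrium path) such that the beliefs start from the prior, follow Bayes' rule after every transition of positive probability, and each player's strategy maximizes her expected reward-to-go at each information set. The acting player plays a partial function $\gamma:\{-1,1\}\to\{0,1\}$ of her signal; $\mathbf 0$, $\mathbf 1$, $\boldsymbol I$ denote "never buy", "always buy", and "buy iff the signal is $1$". A structured policy gives $\gamma_t=\theta[n_t,\pi_t,b_t]$, where $b_t$ records who has bought and $\pi_t$ is the common belief on $(X,V)$, which starts at the prior and is updated by Bayes' rule from $\gamma_t$ and the observed action (no update if that action has probability zero). Let $\tilde x^n_t=\pm1$ if $\pi_t$ is certain that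 $X^n=\pm1$ and $\tilde x_t^n=0$ otherwise (player $n$ has not revealed). With $q=(1-p)/p$, the private belief of player $n$ is $\pi_t(x^{-n}\mid v)\,\pi_t^{pr}(v\mid x^n)$ with $\frac{\pi^{pr}_t(1\mid x^n)}{\pi^{pr}_t(-1\mid x^n)}=\frac{\pi_t(V=1)}{\pi_t(V=-1)}\,q^{-\tilde x_t^n+x^n}$. A PBE generated in this way is a structured PBE (sPBE). Put $r^n_t=|\tilde x^n_t|$, $y_t=\sum_n\tilde x^n_t$, $w_t=\sum_n\max\{|\tilde x_t^n|,b_t^n\}$. A function $\phi[r,y,w]$ defines the structured policy $\theta=\phi[r^{n},y,w]$ if $b^n=0$, and $\theta=\mathbf 0$ if $b^n=1$. *Fixed-point equation.* For $r,z\in\{0,1\}$ put $G^r(r,\gamma)=1$ if $r=0,\gamma=\boldsymbol I$, and $=r$ otherwise; $G^z(z,\gamma,a)=1$ if $z=0$ and ($a=1$ or $\gamma=\boldsymbol I$), and $=z$ otherwise; $G^y(z,y,\gamma,a)=y+2a-1$ if $z=0,\gamma=\boldsymbol I$, and $=y$ otherwise; $G^w(z,w,\gamma,a)=w+G^z(z,\gamma,a)-z$.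 Let $\rho(k)=\frac{q^k-1}{q^k+1}$. The function $\phi$ solves the fixed-point equation if there are real functions $U_a(x,r,y,w)$ and $U_{na}^{\tilde r}(x,z,y,w)$ with the following two properties, for all $x\in\{-1,1\}$, $y\in\mathbb Z$ and $r,\tilde r,z\in\{0,1\}$. (a) For $r\le w\le N-1+r$, $\gamma^*=\phi[r,y,w]$, $(r',y',w')=(G^r(r,\gamma^*),G^y(r,y,\gamma^*,0),G^w(r,w,\gamma^*,0))$ and $$A=\tfrac{\delta}{N}U_a(x,r',y',w')+\tfrac{\delta}{N}(N-w-1+r)U_{na}^{r'}(x,0,y',w')+\tfrac{\delta}{N}(w-r)U_{na}^{r'}(x,1,y',w'),$$ the action $\gamma^*(x)$ attains $\max\{\rho(y+r+x),A\}$ (action $1$ yields the first entry, action $0$ the second), and $U_a(x,r,y,w)$ is the entry chosen by $\gamma^*(x)$. (b) For $\tilde r+z\le w\le N-2+\tilde r+z$ and $\gamma^*=\phi[z,y,w]$, $$U_{na}^{\tilde r}(x,z,y,w)=\tfrac{\delta}{N}\,\mathbb E\big[U_a(x,\tilde r,y',w')+U_{na}^{\tilde r}(x,z',y',w')+(w-z-\tilde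 r)U_{na}^{\tilde r}(x,1,y',w')+(N-w-2+z+\tilde r)U_{na}^{\tilde r}(x,0,y',w')\big],$$ where $(z',y',w')=(G^z(z,\gamma^*,a),G^y(z,y,\gamma^*,a),G^w(z,w,\gamma^*,a))$, $a=\gamma^*(X')$, and $\Pr(X'=x')=\frac{Q(x'|-1)+Q(x'|1)q^{k}}{1+q^{k}}$ with $k=y+\tilde r+x$, $Q(x'|v)=1-p$ if $x'=v$ and $p$ otherwise. A *bad informational cascade* occurs at a public history if the acting player has neither bought nor revealed, and either $V=-1$ and she plays $\mathbf 1$, or $V=1$ and she plays $\mathbf 0$. **Theorem.** Let $\delta=1$ and $$\phi[r,y,w]=\begin{cases}\mathbf 0,& y\le-2,\\ \boldsymbol I,& y\ge-1,\ w<N,\\ \mathbf 1,& y\ge1,\ w=N,\ r=1,\\ \boldsymbol I,& y\in\{0,-1\},\ w=N,\ r=1.\end{cases}$$ Then $\phi$ solves the fixed-point equation, and the structured policy it defines, with the beliefs above, is an sPBE. In this sPBE a player who has neither revealed nor bought never plays $\mathbf 1$, at any public history on or off the equilibrium path. Hence no bad informational cascade ever occurs when $V=-1$. -/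

import Mathlib

open MeasureTheory

noncomputable section

namespace Cascade

/-! ## The game

Product values and private signals live in `{-1, 1} = ℤˣ`; an action is a `Bool`
(`true` = buy, `false` = wait).  Players are the elements of `Fin N`. -/

/-- A partial function `γ` from the private signal of the acting player to her action. -/
abbrev Partial := ℤˣ → Bool

/-- "never buy" (`𝟎`). -/
def neverBuy : Partial := fun _ => false

/-- "always buy" (`𝟏`). -/
def alwaysBuy : Partial := fun _ => true

/-- "buy according to the private signal" (`𝑰`). -/
def followSignal : Partial := fun x => decide (x = 1)

/-- `0` or `1` as a real number. -/
def ind (c : Bool) : ℝ := if c then 1 else 0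

/-- `Q(x | v)`: a signal equals the value with probability `1 - p`. -/
def signalProb (p : ℝ) (x v : ℤˣ) : ℝ := if x = v then 1 - p else p

/-- The turns already played, the latest one first.  The entry `(m, a)` says that `m` was the
acting player and took action `a`; all other players necessarily played `0` in that turn.
A common history `h_t^c = (a_{0:t-1}, n_{0:t})` is such a list of length `t` together with the
player `n_t` who is about to act. -/
abbrev Past (N : ℕ) := List (Fin N × Bool)

/-- `b^n`: player `n` has already bought. -/
def bought {N : ℕ} (h : Past N) (n : Fin N) : Bool := decide ((n, true) ∈ h)

/-- The past respects the action sets: nobody buys twice. -/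
def Past.Valid {N : ℕ} : Past N → Prop
  | [] => True
  | (m, a) :: h => (a = true → bought h m = false) ∧ Past.Valid h

/-- A pure strategy of one player: from her signal, the past and the current acting player to an
action.  The time `t` is the length of the past. -/
abbrev Strategy (N : ℕ) := ℤˣ → Past N → Fin N → Bool

/-- The strategy respects the action sets: player `n` can buy only when she is the acting player
and has not bought before. -/
def Feasible {N : ℕ} (n : Fin N) (s : Strategy N) : Prop :=
  ∀ x h m, s x h m = true → m = n ∧ bought h n = false

/-- Signals of all players other than `n`. -/
abbrev OthersSignals (N : ℕ) (n : Fin N) := {m : Fin N // m ≠ n} → ℤˣ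

/-- The full signal profile made of `x^n` and `x^{-n}`. -/
def combine {N : ℕ} (n : Fin N) (xn : ℤˣ) (xo : OthersSignals N n) : Fin N → ℤˣ :=
  fun m => if hm : m = n then xn else xo ⟨m, hm⟩

/-- A private belief of player `n`, on the pair `(x^{-n}, v)`. -/
abbrev PrivateBelief (N : ℕ) (n : Fin N) := OthersSignals N n × ℤˣ → ℝ

/-- A system of private beliefs: one for each player and each of her information sets. -/
abbrev BeliefSystem (N : ℕ) :=
  (n : Fin N) → ℤˣ → Past N → Fin N → PrivateBelief N n

/-- The common prior on signals and value; both values have probability `1/2` and signals are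
independent given the value. -/
def prior {N : ℕ} (p : ℝ) (x : Fin N → ℤˣ) (v : ℤˣ) : ℝ :=
  (1 / 2) * ∏ i, signalProb p (x i) v

/-- The course of the game under the strategy profile `s` and the signals `x`, started from the
past `h` with acting player `m`, when `ω 0, ω 1, …` are the players chosen in the following turns:
the past and the acting player after `k` turns. -/
def play {N : ℕ} (s : Fin N → Strategy N) (x : Fin N → ℤˣ) (h : Past N) (m : Fin N)
    (ω : ℕ → Fin N) : ℕ → Past N × Fin N
  | 0 => (h, m)
  | k + 1 =>
    let c := play s x h m ω k
    ((c.2, s c.2 (x c.2) c.1 c.2) :: c.1, ω k)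

/-- The law of the sequence of future acting players: independent and uniform. -/
def actorLaw (N : ℕ) [NeZero N] : Measure (ℕ → Fin N) :=
  Measure.infinitePi (fun _ : ℕ => (PMF.uniformOfFintype (Fin N)).toMeasure)

/-- The expected reward-to-go `R^n(s, μ^n, h^n)` of player `n` at her information set
`(xn, h, m)`, with respect to her belief `μn` on the others' signals and the value and the law of
the future acting players: `𝔼 [∑_k δ^k V A^n_{t+k}]`. -/
def rewardToGo {N : ℕ} [NeZero N] (δ : ℝ) (s : Fin N → Strategy N) (n : Fin N)
    (μn : PrivateBelief N n) (xn : ℤˣ) (h : Past N) (m : Fin N) : ℝ :=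
  ∑ e : OthersSignals N n × ℤˣ, μn e *
    ∫ ω, (∑' k : ℕ, δ ^ k * (((e.2 : ℤ) : ℝ) *
      ind (let c := play s (combine n xn e.1) h m ω k
           s n xn c.1 c.2))) ∂(actorLaw N)

/-- The probability, according to the belief of player `n`, that the acting player `m` takes the
action `a` after the past `h`.  As the next acting player is uniform and independent of everything
else, the transition probability to the next information set of player `n` is `1/N` times this. -/
def actionProb {N : ℕ} (s : Fin N → Strategy N) (n : Fin N) (μn : PrivateBelief N n)
    (xn : ℤˣ) (h : Past N) (m : Fin N) (a : Bool) : ℝ :=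
  ∑ e : OthersSignals N n × ℤˣ,
    if s m (combine n xn e.1 m) h m = a then μn e else 0

/-- Perfect Bayesian equilibrium with pure strategies in the game with signal error probability `p`
and discount factor `δ`. -/
structure IsPBE {N : ℕ} [NeZero N] (p δ : ℝ) (s : Fin N → Strategy N)
    (μ : BeliefSystem N) : Prop where
  /-- strategies respect the action sets -/
  feasible : ∀ n, Feasible n (s n)
  /-- beliefs are probability distributions -/
  belief_nonneg : ∀ n xn h m, h.Valid → ∀ e, 0 ≤ μ n xn h m e
  belief_sum : ∀ n xn h m, h.Valid → ∑ e, μ n xn h m e = 1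
  /-- the initial beliefs are the prior conditioned on the player's own signal -/
  initial : ∀ n xn m (e : OthersSignals N n × ℤˣ),
    μ n xn [] m e = prior p (combine n xn e.1) e.2 /
      ∑ e' : OthersSignals N n × ℤˣ, prior p (combine n xn e'.1) e'.2
  /-- Bayesian updating after every turn of positive probability -/
  bayes : ∀ n xn h m a m', Past.Valid ((m, a) :: h) →
    0 < actionProb s n (μ n xn h m) xn h m a → ∀ e : OthersSignals N n × ℤˣ,
    μ n xn ((m, a) :: h) m' e =
      (if s m (combine n xn e.1 m) h m = a then μ n xn h m e else 0) /
        actionProb s n (μ n xn h m) xn h m a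
  /-- sequential rationality at every information set -/
  rational : ∀ n xn h m, h.Valid → ∀ s' : Strategy N, Feasible n s' →
    rewardToGo δ (Function.update s n s') n (μ n xn h m) xn h m ≤
      rewardToGo δ s n (μ n xn h m) xn h m

/-! ## Structured strategies and the forward construction -/

/-- A common belief `π` on `(x, v)`. -/
abbrev CommonBelief (N : ℕ) := (Fin N → ℤˣ) → ℤˣ → ℝ

/-- A structured policy `θ[n, π, b]`: the partial function of the acting player `n` depends on the
common history only through the common belief and the set of players who have bought. -/
abbrev Policy (N : ℕ) := Fin N → CommonBelief N → (Fin N → Bool) → Partial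

/-- The common belief update `F(π, γ, a, n)`: Bayes' rule, and no update when the denominator
vanishes. -/
def updateBelief {N : ℕ} (π : CommonBelief N) (γ : Partial) (a : Bool) (n : Fin N) :
    CommonBelief N := fun x v =>
  let D := ∑ x' : Fin N → ℤˣ, ∑ v' : ℤˣ, if γ (x' n) = a then π x' v' else 0
  if D = 0 then π x v else (if γ (x n) = a then π x v else 0) / D

/-- The common belief generated by the policy `θ` along a past. -/
def commonBelief {N : ℕ} (p : ℝ) (θ : Policy N) : Past N → CommonBelief N
  | [] => prior p
  | (m, a) :: h =>
    updateBelief (commonBelief p θ h) (θ m (commonBelief p θ h) (bought h)) a m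

/-- Marginal of the common belief on the signal of player `n`. -/
def signalMarginal {N : ℕ} (π : CommonBelief N) (n : Fin N) (k : ℤˣ) : ℝ :=
  ∑ x : Fin N → ℤˣ, ∑ v : ℤˣ, if x n = k then π x v else 0

/-- Marginal of the common belief on the value. -/
def valueMarginal {N : ℕ} (π : CommonBelief N) (v : ℤˣ) : ℝ := ∑ x : Fin N → ℤˣ, π x v

/-- The revealed information `x̃^n ∈ {-1, 0, 1}`: it is `k = ±1` when the common belief on the
signal of `n` is the point mass at `k`, and `0` when `n` has not revealed her signal. -/
def revealed {N : ℕ} (π : CommonBelief N) (n : Fin N) : ℤ :=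
  if signalMarginal π n 1 = 1 then 1 else if signalMarginal π n (-1) = 1 then -1 else 0

/-- `q = (1 - p) / p`. -/
def odds (p : ℝ) : ℝ := (1 - p) / p

/-- The strategy profile generated by a structured policy. -/
def forwardStrategy {N : ℕ} (p : ℝ) (θ : Policy N) : Fin N → Strategy N := fun n x h m =>
  if m = n then θ n (commonBelief p θ h) (bought h) x else false

/-- The private odds of `V = 1` against `V = -1` of a player `n` with signal `xn`: the information
revealed by `n` is cancelled from the common odds and replaced by her true signal. -/
def privateOdds {N : ℕ} (p : ℝ) (π : CommonBelief N) (n : Fin N) (xn : ℤˣ) : ℝ :=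
  valueMarginal π 1 / valueMarginal π (-1) * odds p ^ (-revealed π n + (xn : ℤ))

/-- The private beliefs generated by a structured policy, `π(x^{-n} | v) * π^{pr}(v | x^n)`. -/
def forwardBelief {N : ℕ} (p : ℝ) (θ : Policy N) : BeliefSystem N := fun n xn h _ e =>
  let π := commonBelief p θ h
  let L := privateOdds p π n xn
  ((∑ k : ℤˣ, π (combine n k e.1) e.2) / valueMarginal π e.2) *
    (if e.2 = 1 then L / (1 + L) else 1 / (1 + L))

/-- The structured policy `θ` generates a structured perfect Bayesian equilibrium (sPBE). -/
def IsSPBE {N : ℕ} [NeZero N] (p δ : ℝ) (θ : Policy N) : Prop :=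
  IsPBE p δ (forwardStrategy p θ) (forwardBelief p θ)

/-! ## Policies in the variables `(r, y, w)` and their fixed-point equation -/

/-- A policy `φ[r, y, w]` of a player who has not bought: `r` tells whether she has revealed her
signal, `y` is the sum of the revealed signals, and `w` is the number of players who have revealed
their signal or bought. -/
abbrev AggPolicy := Bool → ℤ → ℕ → Partial

/-- `y = ∑ n, x̃^n`. -/
def aggY {N : ℕ} (π : CommonBelief N) : ℤ := ∑ n, revealed π n

/-- `w = ∑ n, max (|x̃^n|, b^n)`. -/
def aggW {N : ℕ} (π : CommonBelief N) (b : Fin N → Bool) : ℕ :=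
  ∑ n, max (revealed π n).natAbs (b n).toNat

/-- The structured policy given by `φ`. -/
def toPolicy (N : ℕ) (φ : AggPolicy) : Policy N := fun n π b =>
  if b n then neverBuy else φ (decide (revealed π n ≠ 0)) (aggY π) (aggW π b)

def Gr (r : Bool) (γ : Partial) : Bool := if r = false ∧ γ = followSignal then true else r

def Gz (z : Bool) (γ : Partial) (a : Bool) : Bool :=
  if z = false ∧ (a = true ∨ γ = followSignal) then true else z

def Gy (z : Bool) (y : ℤ) (γ : Partial) (a : Bool) : ℤ :=
  if z = false ∧ γ = followSignal then y + (if a then 1 else -1) else y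

def Gw (z : Bool) (w : ℕ) (γ : Partial) (a : Bool) : ℕ :=
  w + (Gz z γ a).toNat - z.toNat

/-- The expected value `(q^k - 1) / (q^k + 1)` of the product when the odds are `q^k`. -/
def buyReward (p : ℝ) (k : ℤ) : ℝ := (odds p ^ k - 1) / (odds p ^ k + 1)

/-- The probability of an unrevealed signal `x'` when the odds of `V = 1` are `q^k`. -/
def predProb (p : ℝ) (k : ℤ) (x' : ℤˣ) : ℝ :=
  (signalProb p x' (-1) + signalProb p x' 1 * odds p ^ k) / (1 + odds p ^ k)

/-- The reward of waiting `A` for the acting player with signal `x` in the state `(r, y, w)`. -/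
def waitReward (N : ℕ) (δ : ℝ) (φ : AggPolicy) (Ua : ℤˣ → Bool → ℤ → ℕ → ℝ)
    (Una : Bool → ℤˣ → Bool → ℤ → ℕ → ℝ) (x : ℤˣ) (r : Bool) (y : ℤ) (w : ℕ) : ℝ :=
  let γ := φ r y w
  let r' := Gr r γ
  let y' := Gy r y γ false
  let w' := Gw r w γ false
  δ / N * Ua x r' y' w'
    + δ / N * ((N : ℝ) - w - 1 + ind r) * Una r' x false y' w'
    + δ / N * ((w : ℝ) - ind r) * Una r' x true y' w'

/-- The policy `φ` solves the quadratic-dimensional fixed-point equation: there are value functions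
`Ua` (acting player) and `Una` (non-acting player) satisfying the equations below.

The side conditions select the states `(r, y, w)` that make sense.  An acting player (who has not
bought) is counted in `w` exactly when `r = 1`, and the other `N - 1` players make up the rest,
so `r ≤ w ≤ N - 1 + r`; likewise `r̃ + z ≤ w ≤ N - 2 + r̃ + z` for a non-acting player who faces an
acting player.  The sum `y` ranges over all integers, so that it need not be bounded by `N`. -/
def SolvesFPE (N : ℕ) (p δ : ℝ) (φ : AggPolicy) : Prop :=
  ∃ (Ua : ℤˣ → Bool → ℤ → ℕ → ℝ) (Una : Bool → ℤˣ → Bool → ℤ → ℕ → ℝ),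
    (∀ (x : ℤˣ) (r : Bool) (y : ℤ) (w : ℕ), r.toNat ≤ w → w + 1 ≤ N + r.toNat →
      let buy := buyReward p (y + r.toNat + (x : ℤ))
      let A := waitReward N δ φ Ua Una x r y w
      (φ r y w x = true → A ≤ buy) ∧
      (φ r y w x = false → buy ≤ A) ∧
      Ua x r y w = if φ r y w x then buy else A) ∧
    (∀ (r' : Bool) (x : ℤˣ) (z : Bool) (y : ℤ) (w : ℕ),
      r'.toNat + z.toNat ≤ w → w + 2 ≤ N + r'.toNat + z.toNat →
      let γ := φ z y w
      Una r' x z y w = ∑ x' : ℤˣ, predProb p (y + r'.toNat + (x : ℤ)) x' *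
        (let y' := Gy z y γ (γ x')
         let w' := Gw z w γ (γ x')
         δ / N * Ua x r' y' w'
          + δ / N * Una r' x (Gz z γ (γ x')) y' w'
          + δ / N * ((w : ℝ) - ind z - ind r') * Una r' x true y' w'
          + δ / N * ((N : ℝ) - w - 2 + ind z + ind r') * Una r' x false y' w'))

/-- The profile for `δ = 1`: `𝟎` for `y ≤ -2`; `𝑰` for `y ≥ -1` and `w < N`; and for `w = N`,
`r = 1`: `𝟏` for `y ≥ 1` and `𝑰` for `y ∈ {0, -1}`.  (A player who has neither revealed nor bought
is not counted in `w`, so `r = 0` only occurs with `w < N`.) -/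
def patientProfile (N : ℕ) : AggPolicy := fun r y w =>
  if y ≤ -2 then neverBuy
  else if w < N then followSignal
  else if r = true ∧ 1 ≤ y then alwaysBuy
  else followSignal

/-! ## Informational cascades -/

/-- After the past `h`, player `m` has neither bought nor revealed her signal, according to the
common belief generated by `θ`. -/
def Unrevealed {N : ℕ} (p : ℝ) (θ : Policy N) (h : Past N) (m : Fin N) : Prop :=
  bought h m = false ∧ revealed (commonBelief p θ h) m = 0

/-- The partial function that the acting player `m` plays after the past `h`. -/
def partialOf {N : ℕ} (s : Fin N → Strategy N) (h : Past N) (m : Fin N) : Partial :=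
  fun x => s m x h m

/-- A bad informational cascade when the value is `v`: an acting player who has neither bought nor
revealed disregards her signal, and her action does not fit the value of the product. -/
def IsBadCascade {N : ℕ} (p : ℝ) (θ : Policy N) (v : ℤˣ) (h : Past N) (m : Fin N) : Prop :=
  Unrevealed p θ h m ∧
    ((v = 1 ∧ partialOf (forwardStrategy p θ) h m = neverBuy) ∨
      (v = -1 ∧ partialOf (forwardStrategy p θ) h m = alwaysBuy))

end Cascade

end

/-!
The common belief after any past is the prior conditioned on a *record* of revealed signals
(`commonBelief_eq`): an acting player who is unsettled, meaning that she has neither revealed nor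
bought, plays `followSignal` and thereby adds her signal to the record as long as the sum `y` of
the record is at least `-1`; no other turn is informative.  Accordingly, the private belief of a
player is the prior conditioned on her own signal and on the others' record (`forwardBelief_eq`),
with odds `q ^ k`, where `k = y + r + x` as long as she has not bought: then the record can only
show `-1` for her, since revealing `1` means buying (`bought_of_record_eq_one`, `privateExp_eq`).

The value functions are built from the expected reward before the acting player is drawn.  For a
player who has revealed, this is `revealedValue`: the value of the product is a martingale, so
without discounting she loses nothing by waiting until all signals are known or `y ≤ -2`
(`buyReward_le_revealedValue`); with signal `1` she gains nothing either, since her odds stay at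
least one until the information stops at `y = -2`, where they equal one (`revealedValue_one`).
For an unsettled player it is the average `hiddenValue` over the first unsettled player to act.  The
identity `card_mul_exAnte` turns these functions into a solution of the fixed-point equation, and
the two inequalities above are its optimality conditions (`actValue_optimal`).

A player buys at most once, so her reward-to-go is the limit of the rewards over finite horizons
(`tendsto_rewardToGo`), which satisfy a recursion along the turns.  By induction on the horizon, no
strategy gets more than the value functions (`horizonReward_le`).  The patient profile attains them:
the uncollected part of the value decreases geometrically (`stateValue_sub_le`), because in each
turn, with probability at least `1 / N`, a further player is settled or the player herself buys,
unless she will never buy and the remaining value is zero.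
-/

namespace Cascade

/-! ### Signals and odds -/

lemma sum_signals (f : ℤˣ → ℝ) : ∑ x, f x = f 1 + f (-1) := by
  rw [show (Finset.univ : Finset ℤˣ) = {1, -1} from rfl, Finset.sum_pair (by decide)]

lemma signalProb_pos {p : ℝ} (hp0 : 0 < p) (hp1 : p < 1 / 2) (x v : ℤˣ) :
    0 < signalProb p x v := by
  unfold signalProb; split_ifs <;> linarith

lemma odds_pos {p : ℝ} (hp0 : 0 < p) (hp1 : p < 1 / 2) : 0 < odds p :=
  div_pos (by linarith) hp0

lemma one_lt_odds {p : ℝ} (hp0 : 0 < p) (hp1 : p < 1 / 2) : 1 < odds p := by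
  rw [odds, lt_div_iff₀ hp0]; linarith

lemma sum_signalProb (p : ℝ) (v : ℤˣ) : ∑ x, signalProb p x v = 1 := by
  rw [sum_signals]
  rcases Int.units_eq_one_or v with rfl | rfl <;> norm_num [signalProb]

lemma signalProb_one_eq {p : ℝ} (hp0 : 0 < p) (hp1 : p < 1 / 2) (x : ℤˣ) :
    signalProb p x 1 = signalProb p x (-1) * odds p ^ (x : ℤ) := by
  have : 1 - p ≠ 0 := by linarith
  rcases Int.units_eq_one_or x with rfl | rfl <;> norm_num [signalProb, odds] <;> field_simp

lemma prod_zpow_eq_zpow_sum {ι : Type*} (s : Finset ι) {a : ℝ} (ha : a ≠ 0) (f : ι → ℤ) :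
    ∏ i ∈ s, a ^ f i = a ^ ∑ i ∈ s, f i := by
  classical
  induction s using Finset.induction_on with
  | empty => simp
  | insert i s hi ih => rw [Finset.prod_insert hi, Finset.sum_insert hi, zpow_add₀ ha, ih]

/-- The signal that an action taken under `followSignal` reveals. -/
def actionSignal (a : Bool) : ℤˣ := if a then 1 else -1

lemma followSignal_eq_iff (k : ℤˣ) (a : Bool) : followSignal k = a ↔ k = actionSignal a := by
  revert k a; decide

lemma followSignal_ne_neverBuy : followSignal ≠ neverBuy := by decide
lemma followSignal_ne_alwaysBuy : followSignal ≠ alwaysBuy := by decide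

/-! ### The prior conditioned on a record of revealed signals -/

/-- The likelihood of the signal `k` of a player whose recorded signal is `c` (`none` when nothing
is recorded), given the value `v`. -/
def likelihood (p : ℝ) (c : Option ℤˣ) (k v : ℤˣ) : ℝ :=
  if c = none ∨ c = some k then signalProb p k v else 0

/-- The likelihood of the record entry `c` given the value `v`. -/
def mass (p : ℝ) (c : Option ℤˣ) (v : ℤˣ) : ℝ := c.elim 1 fun u => signalProb p u v

/-- The recorded signal as an element of `{-1, 0, 1}`. -/
def shown (c : Option ℤˣ) : ℤ := c.elim 0 fun u => (u : ℤ)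

@[simp] lemma shown_none : shown none = 0 := rfl
@[simp] lemma shown_some (u : ℤˣ) : shown (some u) = u := rfl

lemma shown_ne_zero_iff (c : Option ℤˣ) : shown c ≠ 0 ↔ c.isSome = true := by
  revert c; decide

lemma sum_likelihood (p : ℝ) (c : Option ℤˣ) (v : ℤˣ) :
    ∑ k, likelihood p c k v = mass p c v := by
  cases c with
  | none => simpa [likelihood, mass] using sum_signalProb p v
  | some u =>
    have h : ∀ k, likelihood p (some u) k v = if u = k then signalProb p k v else 0 := by
      simp [likelihood]
    simp only [h, mass, Option.elim, Finset.sum_ite_eq, Finset.mem_univ, if_true]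

lemma likelihood_some_eq (p : ℝ) (u k v : ℤˣ) :
    likelihood p (some u) k v = if k = u then likelihood p none k v else 0 := by
  simp [likelihood, eq_comm]

lemma mass_pos {p : ℝ} (hp0 : 0 < p) (hp1 : p < 1 / 2) (c : Option ℤˣ) (v : ℤˣ) :
    0 < mass p c v := by
  cases c with
  | none => simp [mass]
  | some u => exact signalProb_pos hp0 hp1 u v

lemma mass_one_eq {p : ℝ} (hp0 : 0 < p) (hp1 : p < 1 / 2) (c : Option ℤˣ) :
    mass p c 1 = mass p c (-1) * odds p ^ shown c := by
  cases c with
  | none => simp [mass]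
  | some u => exact signalProb_one_eq hp0 hp1 u

lemma likelihood_nonneg {p : ℝ} (hp0 : 0 < p) (hp1 : p < 1 / 2) (c : Option ℤˣ) (k v : ℤˣ) :
    0 ≤ likelihood p c k v := by
  unfold likelihood; split_ifs
  · exact (signalProb_pos hp0 hp1 k v).le
  · exact le_rfl

variable {N : ℕ}

/-- The weight of a signal profile and a value, given the record `ξ`; this is twice the prior on
the profiles that agree with the record. -/
def condWeight (p : ℝ) (ξ : Fin N → Option ℤˣ) (x : Fin N → ℤˣ) (v : ℤˣ) : ℝ :=
  ∏ i, likelihood p (ξ i) (x i) v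

/-- The total weight of the profiles that agree with the record. -/
def condTotal (p : ℝ) (ξ : Fin N → Option ℤˣ) : ℝ := ∑ v : ℤˣ, ∏ i, mass p (ξ i) v

/-- The prior conditioned on the record `ξ`. -/
noncomputable def condBelief (p : ℝ) (ξ : Fin N → Option ℤˣ) : CommonBelief N := fun x v =>
  condWeight p ξ x v / condTotal p ξ

lemma sum_condWeight (p : ℝ) (ξ : Fin N → Option ℤˣ) (v : ℤˣ) :
    ∑ x, condWeight p ξ x v = ∏ i, mass p (ξ i) v := by
  simp only [condWeight, ← sum_likelihood, Fintype.prod_sum]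

lemma sum_sum_condWeight (p : ℝ) (ξ : Fin N → Option ℤˣ) :
    ∑ x, ∑ v, condWeight p ξ x v = condTotal p ξ := by
  rw [Finset.sum_comm]; simp only [sum_condWeight, condTotal]

lemma condTotal_pos {p : ℝ} (hp0 : 0 < p) (hp1 : p < 1 / 2) (ξ : Fin N → Option ℤˣ) :
    0 < condTotal p ξ :=
  Finset.sum_pos (fun _ _ => Finset.prod_pos fun _ _ => mass_pos hp0 hp1 _ _)
    Finset.univ_nonempty

lemma sum_condBelief {p : ℝ} (hp0 : 0 < p) (hp1 : p < 1 / 2) (ξ : Fin N → Option ℤˣ) :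
    ∑ x, ∑ v, condBelief p ξ x v = 1 := by
  simp only [condBelief, ← Finset.sum_div]
  rw [sum_sum_condWeight, div_self (condTotal_pos hp0 hp1 ξ).ne']

/-- Restricting to the profiles with signal `k` of an unrecorded player amounts to recording `k`. -/
lemma condWeight_update (p : ℝ) {ξ : Fin N → Option ℤˣ} {m : Fin N} (hm : ξ m = none) (k : ℤˣ)
    (x : Fin N → ℤˣ) (v : ℤˣ) :
    (if x m = k then condWeight p ξ x v else 0) =
      condWeight p (Function.update ξ m (some k)) x v := by
  unfold condWeight
  rw [← Finset.mul_prod_erase _ _ (Finset.mem_univ m),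
    ← Finset.mul_prod_erase _ (fun i => likelihood p (Function.update ξ m (some k) i) (x i) v)
      (Finset.mem_univ m), Function.update_self, hm, likelihood_some_eq, ite_mul, zero_mul]
  congr 2
  refine Finset.prod_congr rfl fun i hi => ?_
  rw [Function.update_of_ne (Finset.ne_of_mem_erase hi)]

lemma eq_of_condWeight_ne_zero {p : ℝ} {ξ : Fin N → Option ℤˣ} {x : Fin N → ℤˣ} {v : ℤˣ}
    (h : condWeight p ξ x v ≠ 0) (m : Fin N) : ξ m = none ∨ ξ m = some (x m) := by
  have := Finset.prod_ne_zero_iff.1 h m (Finset.mem_univ m)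
  by_contra hc
  exact this (if_neg hc)

lemma signalMarginal_condBelief_of_none (p : ℝ) {ξ : Fin N → Option ℤˣ} {m : Fin N}
    (hm : ξ m = none) (k : ℤˣ) :
    signalMarginal (condBelief p ξ) m k =
      condTotal p (Function.update ξ m (some k)) / condTotal p ξ := by
  rw [← sum_sum_condWeight]
  simp only [signalMarginal, condBelief, ← condWeight_update p hm, Finset.sum_div, ite_div,
    zero_div]

lemma signalMarginal_add {π : CommonBelief N} (m : Fin N) :
    signalMarginal π m 1 + signalMarginal π m (-1) = ∑ x, ∑ v, π x v := by
  simp only [signalMarginal, ← Finset.sum_add_distrib]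
  refine Finset.sum_congr rfl fun x _ => Finset.sum_congr rfl fun v _ => ?_
  rcases Int.units_eq_one_or (x m) with h | h <;> simp [h]

lemma signalMarginal_condBelief_of_some {p : ℝ} (hp0 : 0 < p) (hp1 : p < 1 / 2)
    {ξ : Fin N → Option ℤˣ} {m : Fin N} {u : ℤˣ} (hm : ξ m = some u) (k : ℤˣ) :
    signalMarginal (condBelief p ξ) m k = if u = k then 1 else 0 := by
  have key : ∀ x v, condBelief p ξ x v ≠ 0 → x m = u := by
    intro x v h
    have := eq_of_condWeight_ne_zero (fun h0 => h (by rw [condBelief, h0, zero_div])) m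
    simpa [hm, eq_comm] using this
  unfold signalMarginal
  split_ifs with h
  · rw [← sum_condBelief hp0 hp1 ξ]
    refine Finset.sum_congr rfl fun x _ => Finset.sum_congr rfl fun v _ => ?_
    split_ifs with hx
    · rfl
    · by_contra hne
      exact hx ((key x v (Ne.symm hne)).trans h)
  · refine Finset.sum_eq_zero fun x _ => Finset.sum_eq_zero fun v _ => ?_
    split_ifs with hx
    · by_contra hne
      exact h ((key x v hne).symm.trans hx)
    · rfl

lemma revealed_condBelief {p : ℝ} (hp0 : 0 < p) (hp1 : p < 1 / 2) (ξ : Fin N → Option ℤˣ)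
    (m : Fin N) : revealed (condBelief p ξ) m = shown (ξ m) := by
  unfold revealed
  cases hm : ξ m with
  | some u =>
    rw [signalMarginal_condBelief_of_some hp0 hp1 hm, signalMarginal_condBelief_of_some hp0 hp1 hm]
    rcases Int.units_eq_one_or u with rfl | rfl
    · simp
    · rw [if_neg (by rw [if_neg (by decide)]; norm_num)]; simp
  | none =>
    have h := signalMarginal_add (π := condBelief p ξ) m
    rw [sum_condBelief hp0 hp1] at h
    have pos : ∀ k, 0 < signalMarginal (condBelief p ξ) m k := fun k => by
      rw [signalMarginal_condBelief_of_none p hm]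
      exact div_pos (condTotal_pos hp0 hp1 _) (condTotal_pos hp0 hp1 _)
    have h1 := pos 1
    have h2 := pos (-1)
    rw [if_neg (by linarith), if_neg (by linarith)]; rfl

/-- An action that is the same for all profiles of positive probability conveys no information. -/
lemma updateBelief_of_const {π : CommonBelief N} (hπ : ∑ x, ∑ v, π x v = 1) {γ : Partial}
    {m : Fin N} {b : Bool} (hb : ∀ x v, π x v ≠ 0 → γ (x m) = b) (a : Bool) :
    updateBelief π γ a m = π := by
  have key : ∀ x v, (if γ (x m) = a then π x v else 0) = if b = a then π x v else 0 := by
    intro x v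
    by_cases h : π x v = 0
    · simp [h]
    · rw [hb x v h]
  funext x v
  by_cases h : b = a
  · simp only [updateBelief, key, h, if_true, hπ, div_one, one_ne_zero, if_false]
  · simp only [updateBelief, key, h, if_false, Finset.sum_const_zero, if_true]

lemma updateBelief_condBelief_followSignal {p : ℝ} (hp0 : 0 < p) (hp1 : p < 1 / 2)
    {ξ : Fin N → Option ℤˣ} {m : Fin N} (hm : ξ m = none) (a : Bool) :
    updateBelief (condBelief p ξ) followSignal a m =
      condBelief p (Function.update ξ m (some (actionSignal a))) := by
  have h1 := (condTotal_pos hp0 hp1 ξ).ne'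
  have h2 := (condTotal_pos hp0 hp1 (Function.update ξ m (some (actionSignal a)))).ne'
  have key : ∀ x v, (if followSignal (x m) = a then condBelief p ξ x v else 0) =
      condWeight p (Function.update ξ m (some (actionSignal a))) x v / condTotal p ξ := by
    intro x v
    simp only [followSignal_eq_iff, condBelief, ← condWeight_update p hm, ite_div, zero_div]
  funext x v
  simp only [updateBelief, key, ← Finset.sum_div, sum_sum_condWeight]
  rw [if_neg (div_ne_zero h2 h1), condBelief]
  field_simp

/-! ### The record generated by the patient profile -/

/-- `y`: the sum of the recorded signals. -/
def recordSum (ξ : Fin N → Option ℤˣ) : ℤ := ∑ i, shown (ξ i)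

/-- Player `i` has a recorded signal or has bought. -/
def settled (ξ : Fin N → Option ℤˣ) (h : Past N) (i : Fin N) : Bool := (ξ i).isSome || bought h i

/-- `w`: the number of settled players. -/
def settledCount (ξ : Fin N → Option ℤˣ) (h : Past N) : ℕ := ∑ i, (settled ξ h i).toNat

/-- The signals that are common knowledge after a past of the patient profile: every turn of an
unsettled player adds her signal as long as the sum `y` is at least `-1`. -/
def record : Past N → Fin N → Option ℤˣ
  | [] => fun _ => none
  | (m, a) :: h =>
    if settled (record h) h m = false ∧ -1 ≤ recordSum (record h) then
      Function.update (record h) m (some (actionSignal a))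
    else record h

/-- The partial function that the patient profile prescribes to an acting player. -/
def prescribed (h : Past N) (m : Fin N) : Partial :=
  if bought h m then neverBuy
  else patientProfile N (record h m).isSome (recordSum (record h)) (settledCount (record h) h)

lemma settledCount_eq (ξ : Fin N → Option ℤˣ) (h : Past N) (m : Fin N) :
    settledCount ξ h =
      (settled ξ h m).toNat + ∑ i : {i // i ≠ m}, (settled ξ h i).toNat :=
  Fintype.sum_eq_add_sum_subtype_ne _ m

lemma sum_others_settled_le (ξ : Fin N → Option ℤˣ) (h : Past N) (m : Fin N) :
    ∑ i : {i // i ≠ m}, (settled ξ h i).toNat + 1 ≤ N := by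
  have h1 : ∑ i : {i // i ≠ m}, (settled ξ h i).toNat ≤ ∑ i : {i : Fin N // i ≠ m}, 1 :=
    Finset.sum_le_sum fun i _ => Bool.toNat_le _
  have h2 := Fintype.sum_eq_add_sum_subtype_ne (fun _ : Fin N => 1) m
  simp only [Finset.sum_const, Finset.card_univ, Fintype.card_fin, smul_eq_mul, mul_one] at h1 h2
  omega

lemma settledCount_lt {ξ : Fin N → Option ℤˣ} {h : Past N} {m : Fin N}
    (hm : settled ξ h m = false) : settledCount ξ h < N := by
  have := settledCount_eq ξ h m
  have := sum_others_settled_le ξ h m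
  simp_all

lemma settledCount_le (ξ : Fin N → Option ℤˣ) (h : Past N) : settledCount ξ h ≤ N := by
  have h1 : settledCount ξ h ≤ ∑ _i : Fin N, 1 := Finset.sum_le_sum fun i _ => Bool.toNat_le _
  simpa using h1

lemma exists_not_settled {ξ : Fin N → Option ℤˣ} {h : Past N} (hw : settledCount ξ h < N) :
    ∃ m, settled ξ h m = false := by
  by_contra hc
  simp only [not_exists, Bool.not_eq_false] at hc
  simp [settledCount, hc] at hw

lemma prescribed_eq_followSignal {h : Past N} {m : Fin N} (hm : settled (record h) h m = false)
    (hy : -1 ≤ recordSum (record h)) : prescribed h m = followSignal := by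
  have hb : bought h m = false := by simp_all [settled]
  rw [prescribed, if_neg (by simp [hb]), patientProfile, if_neg (by omega),
    if_pos (settledCount_lt hm)]

lemma prescribed_eq_neverBuy {h : Past N} {m : Fin N}
    (hy : ¬ -1 ≤ recordSum (record h)) : prescribed h m = neverBuy := by
  unfold prescribed patientProfile
  rw [if_pos (by omega : recordSum (record h) ≤ -2), ite_self]

/-- Without a new record entry, the action is determined by the record. -/
lemma prescribed_const {h : Past N} {m : Fin N}
    (hm : ¬ (settled (record h) h m = false ∧ -1 ≤ recordSum (record h))) :
    ∃ b, ∀ k, record h m = none ∨ record h m = some k → prescribed h m k = b := by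
  by_cases hy : -1 ≤ recordSum (record h)
  · cases hr : record h m with
    | none =>
      have hb : bought h m = true := by simpa [settled, hr, hy] using hm
      exact ⟨false, fun k _ => by simp [prescribed, hb, neverBuy]⟩
    | some u => exact ⟨prescribed h m u, fun k hk => by simp_all⟩
  · exact ⟨false, fun k _ => by rw [prescribed_eq_neverBuy hy]; rfl⟩

variable {p : ℝ}

lemma toPolicy_condBelief (hp0 : 0 < p) (hp1 : p < 1 / 2) (h : Past N) (m : Fin N) :
    toPolicy N (patientProfile N) m (condBelief p (record h)) (bought h) = prescribed h m := by
  have h1 : aggY (condBelief p (record h)) = recordSum (record h) := by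
    simp only [aggY, revealed_condBelief hp0 hp1, recordSum]
  have h2 : aggW (condBelief p (record h)) (bought h) = settledCount (record h) h := by
    simp only [aggW, revealed_condBelief hp0 hp1, settledCount, settled]
    refine Finset.sum_congr rfl fun i _ => ?_
    generalize record h i = c
    generalize bought h i = b
    revert c b; decide
  have h3 : decide (shown (record h m) ≠ 0) = (record h m).isSome := by
    rw [Bool.eq_iff_iff, decide_eq_true_iff, shown_ne_zero_iff]
  rw [toPolicy, h1, h2, revealed_condBelief hp0 hp1, h3, prescribed]

lemma commonBelief_eq (hp0 : 0 < p) (hp1 : p < 1 / 2) (h : Past N) :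
    commonBelief p (toPolicy N (patientProfile N)) h = condBelief p (record h) := by
  induction h with
  | nil =>
    funext x v
    have : condTotal p (record ([] : Past N)) = 2 := by
      simp [condTotal, record, mass]
    rw [commonBelief, condBelief, this, prior, condWeight]
    simp [record, likelihood]; ring
  | cons c h ih =>
    obtain ⟨m, a⟩ := c
    rw [commonBelief, ih, toPolicy_condBelief hp0 hp1, record]
    split_ifs with hc
    · have hr : record h m = none := by simpa [settled] using (Bool.or_eq_false_iff.1 hc.1).1
      rw [prescribed_eq_followSignal hc.1 hc.2, updateBelief_condBelief_followSignal hp0 hp1 hr]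
    · obtain ⟨b, hb⟩ := prescribed_const hc
      refine updateBelief_of_const (sum_condBelief hp0 hp1 _) (b := b) (fun x v hx => hb _ ?_) a
      exact eq_of_condWeight_ne_zero (fun h0 => hx (by rw [condBelief, h0, zero_div])) m

lemma forwardStrategy_eq (hp0 : 0 < p) (hp1 : p < 1 / 2) (n : Fin N) (x : ℤˣ) (h : Past N)
    (m : Fin N) :
    forwardStrategy p (toPolicy N (patientProfile N)) n x h m =
      if m = n then prescribed h n x else false := by
  rw [forwardStrategy, commonBelief_eq hp0 hp1, toPolicy_condBelief hp0 hp1]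

/-! ### The private beliefs -/

/-- The weight that player `n` with signal `k` gives to the others' signals and the value: the
likelihood of her own signal, and the others' likelihoods given the record.  Her own record entry
plays no role. -/
def privateWeight (p : ℝ) (ξ : Fin N → Option ℤˣ) (n : Fin N) (k : ℤˣ)
    (e : OthersSignals N n × ℤˣ) : ℝ :=
  signalProb p k e.2 * ∏ m : {m // m ≠ n}, likelihood p (ξ m) (e.1 m) e.2

/-- The total weight of the value `v` for player `n`. -/
def valueWeight (p : ℝ) (ξ : Fin N → Option ℤˣ) (n : Fin N) (k v : ℤˣ) : ℝ :=
  signalProb p k v * ∏ m : {m // m ≠ n}, mass p (ξ m) v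

/-- The exponent `k` for which the private odds of player `n` with signal `x` are `q^k`. -/
def privateExp (ξ : Fin N → Option ℤˣ) (n : Fin N) (x : ℤˣ) : ℤ :=
  ∑ m : {m // m ≠ n}, shown (ξ m) + (x : ℤ)

/-- The private belief: the prior conditioned on the own signal and the others' record. -/
noncomputable def privateCond (p : ℝ) (ξ : Fin N → Option ℤˣ) (n : Fin N) (k : ℤˣ) :
    PrivateBelief N n :=
  fun e => privateWeight p ξ n k e / ∑ v, valueWeight p ξ n k v

lemma sum_privateWeight_snd (p : ℝ) (ξ : Fin N → Option ℤˣ) (n : Fin N) (k v : ℤˣ) :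
    ∑ xo, privateWeight p ξ n k (xo, v) = valueWeight p ξ n k v := by
  simp only [privateWeight, valueWeight, ← Finset.mul_sum, ← sum_likelihood, Fintype.prod_sum]

lemma sum_privateWeight (p : ℝ) (ξ : Fin N → Option ℤˣ) (n : Fin N) (k : ℤˣ) :
    ∑ e, privateWeight p ξ n k e = ∑ v, valueWeight p ξ n k v := by
  rw [Fintype.sum_prod_type_right]
  simp only [sum_privateWeight_snd]

lemma valueWeight_pos (hp0 : 0 < p) (hp1 : p < 1 / 2) (ξ : Fin N → Option ℤˣ) (n : Fin N)
    (k v : ℤˣ) : 0 < valueWeight p ξ n k v :=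
  mul_pos (signalProb_pos hp0 hp1 _ _) (Finset.prod_pos fun _ _ => mass_pos hp0 hp1 _ _)

lemma sum_valueWeight_pos (hp0 : 0 < p) (hp1 : p < 1 / 2) (ξ : Fin N → Option ℤˣ) (n : Fin N)
    (k : ℤˣ) : 0 < ∑ v, valueWeight p ξ n k v :=
  Finset.sum_pos (fun _ _ => valueWeight_pos hp0 hp1 _ _ _ _) Finset.univ_nonempty

lemma valueWeight_one_eq (hp0 : 0 < p) (hp1 : p < 1 / 2) (ξ : Fin N → Option ℤˣ) (n : Fin N)
    (k : ℤˣ) :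
    valueWeight p ξ n k 1 = valueWeight p ξ n k (-1) * odds p ^ privateExp ξ n k := by
  have hq := (odds_pos hp0 hp1).ne'
  simp only [valueWeight, privateExp]
  rw [signalProb_one_eq hp0 hp1, zpow_add₀ hq, ← prod_zpow_eq_zpow_sum _ hq]
  simp only [mass_one_eq hp0 hp1, Finset.prod_mul_distrib]
  ring

lemma prod_mass_eq (p : ℝ) (ξ : Fin N → Option ℤˣ) (n : Fin N) (v : ℤˣ) :
    ∏ i, mass p (ξ i) v = mass p (ξ n) v * ∏ m : {m // m ≠ n}, mass p (ξ m) v :=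
  Fintype.prod_eq_mul_prod_subtype_ne _ n

lemma valueMarginal_condBelief (p : ℝ) (ξ : Fin N → Option ℤˣ) (v : ℤˣ) :
    valueMarginal (condBelief p ξ) v = (∏ i, mass p (ξ i) v) / condTotal p ξ := by
  simp only [valueMarginal, condBelief, ← Finset.sum_div, sum_condWeight]

lemma condWeight_combine (p : ℝ) (ξ : Fin N → Option ℤˣ) (n : Fin N) (k : ℤˣ)
    (xo : OthersSignals N n) (v : ℤˣ) :
    condWeight p ξ (combine n k xo) v =
      likelihood p (ξ n) k v * ∏ m : {m // m ≠ n}, likelihood p (ξ m) (xo m) v := by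
  rw [condWeight, Fintype.prod_eq_mul_prod_subtype_ne _ n]
  congr 1
  · simp [combine]
  · refine Finset.prod_congr rfl fun m _ => ?_
    rw [combine, dif_neg m.2]

/-- The private odds of the forward construction are the odds of `privateCond`. -/
lemma privateOdds_condBelief (hp0 : 0 < p) (hp1 : p < 1 / 2) (ξ : Fin N → Option ℤˣ) (n : Fin N)
    (k : ℤˣ) :
    privateOdds p (condBelief p ξ) n k = valueWeight p ξ n k 1 / valueWeight p ξ n k (-1) := by
  have hq := (odds_pos hp0 hp1).ne'
  have h1 := (mass_pos hp0 hp1 (ξ n) (-1)).ne'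
  have h2 := (signalProb_pos hp0 hp1 k (-1)).ne'
  have h3 := (condTotal_pos hp0 hp1 ξ).ne'
  have h4 : ∏ m : {m // m ≠ n}, mass p (ξ m) (-1) ≠ 0 :=
    Finset.prod_ne_zero_iff.2 fun _ _ => (mass_pos hp0 hp1 _ _).ne'
  rw [privateOdds, valueMarginal_condBelief, valueMarginal_condBelief, prod_mass_eq p ξ n,
    prod_mass_eq p ξ n, revealed_condBelief hp0 hp1, valueWeight, valueWeight,
    mass_one_eq hp0 hp1 (ξ n), signalProb_one_eq hp0 hp1 k, zpow_add₀ hq, zpow_neg]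
  have h5 := zpow_ne_zero (shown (ξ n)) hq
  field_simp

lemma forwardBelief_eq (hp0 : 0 < p) (hp1 : p < 1 / 2) (n : Fin N) (k : ℤˣ) (h : Past N)
    (m : Fin N) :
    forwardBelief p (toPolicy N (patientProfile N)) n k h m = privateCond p (record h) n k := by
  funext ⟨xo, v⟩
  generalize hξ : record h = ξ
  have h1 := (mass_pos hp0 hp1 (ξ n) v).ne'
  have h3 := (condTotal_pos hp0 hp1 ξ).ne'
  have h4 : ∏ m : {m // m ≠ n}, mass p (ξ m) v ≠ 0 :=
    Finset.prod_ne_zero_iff.2 fun _ _ => (mass_pos hp0 hp1 _ _).ne'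
  have a1 := valueWeight_pos hp0 hp1 ξ n k 1
  have a2 := valueWeight_pos hp0 hp1 ξ n k (-1)
  have a3 : valueWeight p ξ n k 1 + valueWeight p ξ n k (-1) ≠ 0 := by positivity
  have a4 : 1 + valueWeight p ξ n k 1 / valueWeight p ξ n k (-1) ≠ 0 := by positivity
  have hv : (if v = 1 then
        valueWeight p ξ n k 1 / valueWeight p ξ n k (-1) /
          (1 + valueWeight p ξ n k 1 / valueWeight p ξ n k (-1))
      else 1 / (1 + valueWeight p ξ n k 1 / valueWeight p ξ n k (-1))) =
      valueWeight p ξ n k v / ∑ v, valueWeight p ξ n k v := by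
    rw [sum_signals]
    have a5 := a1.ne'
    have a6 := a2.ne'
    rcases Int.units_eq_one_or v with rfl | rfl
    · rw [if_pos rfl]; field_simp; ring
    · rw [if_neg (by decide)]; field_simp; ring
  simp only [forwardBelief, commonBelief_eq hp0 hp1, privateOdds_condBelief hp0 hp1, hξ]
  rw [hv, valueMarginal_condBelief, prod_mass_eq p ξ n]
  simp only [condBelief, condWeight_combine, ← Finset.sum_div, ← Finset.sum_mul, sum_likelihood]
  have hS := (sum_valueWeight_pos hp0 hp1 ξ n k).ne'
  rw [privateCond, privateWeight, valueWeight]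
  field_simp

lemma privateCond_nonneg (hp0 : 0 < p) (hp1 : p < 1 / 2) (ξ : Fin N → Option ℤˣ) (n : Fin N)
    (k : ℤˣ) (e : OthersSignals N n × ℤˣ) : 0 ≤ privateCond p ξ n k e :=
  div_nonneg (mul_nonneg (signalProb_pos hp0 hp1 _ _).le
    (Finset.prod_nonneg fun _ _ => likelihood_nonneg hp0 hp1 _ _ _))
    (sum_valueWeight_pos hp0 hp1 ξ n k).le

lemma sum_privateCond (hp0 : 0 < p) (hp1 : p < 1 / 2) (ξ : Fin N → Option ℤˣ) (n : Fin N)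
    (k : ℤˣ) : ∑ e, privateCond p ξ n k e = 1 := by
  simp only [privateCond, ← Finset.sum_div]
  rw [sum_privateWeight, div_self (sum_valueWeight_pos hp0 hp1 ξ n k).ne']

/-- The expected value of the product under the private belief. -/
lemma sum_privateCond_value (hp0 : 0 < p) (hp1 : p < 1 / 2) (ξ : Fin N → Option ℤˣ) (n : Fin N)
    (k : ℤˣ) :
    ∑ e, privateCond p ξ n k e * ((e.2 : ℤ) : ℝ) = buyReward p (privateExp ξ n k) := by
  have a2 := valueWeight_pos hp0 hp1 ξ n k (-1)
  have hq : 0 < odds p ^ privateExp ξ n k := zpow_pos (odds_pos hp0 hp1) _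
  rw [Fintype.sum_prod_type_right]
  simp only [privateCond, ← Finset.sum_mul, ← Finset.sum_div, sum_privateWeight_snd]
  rw [sum_signals, sum_signals, valueWeight_one_eq hp0 hp1, buyReward]
  have : valueWeight p ξ n k (-1) * odds p ^ privateExp ξ n k + valueWeight p ξ n k (-1) ≠ 0 := by
    positivity
  push_cast
  field_simp
  ring

lemma privateCond_update_self (p : ℝ) (ξ : Fin N → Option ℤˣ) (n : Fin N) (k : ℤˣ)
    (c : Option ℤˣ) : privateCond p (Function.update ξ n c) n k = privateCond p ξ n k := by
  have h : ∀ m : {m // m ≠ n}, Function.update ξ n c m = ξ m := fun m =>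
    Function.update_of_ne m.2 _ _
  funext e
  simp only [privateCond, privateWeight, valueWeight, h]

lemma privateWeight_update (p : ℝ) {ξ : Fin N → Option ℤˣ} {n : Fin N} {m : {m // m ≠ n}}
    (hm : ξ m = none) (k u : ℤˣ) (e : OthersSignals N n × ℤˣ) :
    (if e.1 m = u then privateWeight p ξ n k e else 0) =
      privateWeight p (Function.update ξ m (some u)) n k e := by
  unfold privateWeight
  rw [← Finset.mul_prod_erase _ _ (Finset.mem_univ m),
    ← Finset.mul_prod_erase _
      (fun i : {m // m ≠ n} => likelihood p (Function.update ξ m (some u) i) (e.1 i) e.2)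
      (Finset.mem_univ m), Function.update_self, hm, likelihood_some_eq, ite_mul, zero_mul,
    mul_ite, mul_zero]
  congr 3
  refine Finset.prod_congr rfl fun i hi => ?_
  rw [Function.update_of_ne fun h => Finset.ne_of_mem_erase hi (Subtype.ext h)]

lemma valueWeight_update (p : ℝ) {ξ : Fin N → Option ℤˣ} {n : Fin N} {m : {m // m ≠ n}}
    (hm : ξ m = none) (k u v : ℤˣ) :
    valueWeight p (Function.update ξ m (some u)) n k v =
      signalProb p u v * valueWeight p ξ n k v := by
  unfold valueWeight
  rw [← Finset.mul_prod_erase _ _ (Finset.mem_univ m),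
    ← Finset.mul_prod_erase _ (fun i : {m // m ≠ n} => mass p (ξ i) v)
      (Finset.mem_univ m), Function.update_self, hm,
    Finset.prod_congr rfl fun i (hi : i ∈ Finset.univ.erase m) => by
      rw [Function.update_of_ne fun h => Finset.ne_of_mem_erase hi (Subtype.ext h)]]
  simp only [mass, Option.elim]
  ring

lemma eq_of_privateCond_ne_zero {ξ : Fin N → Option ℤˣ} {n : Fin N} {k : ℤˣ}
    {e : OthersSignals N n × ℤˣ} (h : privateCond p ξ n k e ≠ 0) (m : {m // m ≠ n}) :
    ξ m = none ∨ ξ m = some (e.1 m) := by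
  have hw : privateWeight p ξ n k e ≠ 0 := fun h0 => h (by rw [privateCond, h0, zero_div])
  have := Finset.prod_ne_zero_iff.1 (right_ne_zero_of_mul hw) m (Finset.mem_univ m)
  by_contra hc
  exact this (if_neg hc)

/-! ### Bayesian updating of the private beliefs -/

/-- The probability that player `n` with signal `k` assigns to the action `a` of the acting
player `m` under the patient profile. -/
noncomputable def observeProb (p : ℝ) (n : Fin N) (k : ℤˣ) (h : Past N) (m : Fin N)
    (a : Bool) : ℝ :=
  ∑ e : OthersSignals N n × ℤˣ,
    if prescribed h m (combine n k e.1 m) = a then privateCond p (record h) n k e else 0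

lemma observeProb_nonneg (hp0 : 0 < p) (hp1 : p < 1 / 2) (n : Fin N) (k : ℤˣ) (h : Past N)
    (m : Fin N) (a : Bool) : 0 ≤ observeProb p n k h m a := by
  refine Finset.sum_nonneg fun e _ => ?_
  split_ifs
  · exact privateCond_nonneg hp0 hp1 _ _ _ _
  · exact le_rfl

lemma sum_observeProb (hp0 : 0 < p) (hp1 : p < 1 / 2) (n : Fin N) (k : ℤˣ) (h : Past N)
    (m : Fin N) : ∑ a, observeProb p n k h m a = 1 := by
  simp only [observeProb]
  rw [Finset.sum_comm]
  simp only [Finset.sum_ite_eq, Finset.mem_univ, if_true]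
  exact sum_privateCond hp0 hp1 _ _ _

lemma ite_eq_sum_mul_of_const {ι : Type*} [Fintype ι] {μ : ι → ℝ} (hμ : ∑ e, μ e = 1)
    {f : ι → Bool} {b : Bool} (hb : ∀ e, μ e ≠ 0 → f e = b) (a : Bool) (e : ι) :
    (if f e = a then μ e else 0) = (∑ e', if f e' = a then μ e' else 0) * μ e := by
  have key : ∀ e, (if f e = a then μ e else 0) = if b = a then μ e else 0 := by
    intro e
    by_cases h : μ e = 0
    · simp [h]
    · rw [hb e h]
  simp only [key]
  by_cases h : b = a <;> simp [h, hμ]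

lemma combine_self (n : Fin N) (k : ℤˣ) (xo : OthersSignals N n) : combine n k xo n = k := by
  simp [combine]

lemma combine_other (n : Fin N) (k : ℤˣ) (xo : OthersSignals N n) (m : {m // m ≠ n}) :
    combine n k xo m = xo m := by
  rw [combine, dif_neg m.2]

/-- Bayes' rule for the private beliefs, multiplied out: observing the action `a` of player `m`
turns the belief given the record of `h` into the belief given the record of `(m, a) :: h`. -/
lemma observe_mul (hp0 : 0 < p) (hp1 : p < 1 / 2) (n : Fin N) (k : ℤˣ) (h : Past N)
    (m : Fin N) (a : Bool) (e : OthersSignals N n × ℤˣ) :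
    (if prescribed h m (combine n k e.1 m) = a then privateCond p (record h) n k e else 0) =
      observeProb p n k h m a * privateCond p (record ((m, a) :: h)) n k e := by
  have hsum := sum_privateCond hp0 hp1 (record h) n k
  by_cases hmn : m = n
  · subst hmn
    have hr : privateCond p (record ((m, a) :: h)) m k = privateCond p (record h) m k := by
      rw [record]; split_ifs
      · exact privateCond_update_self _ _ _ _ _
      · rfl
    rw [hr]
    exact ite_eq_sum_mul_of_const hsum (f := fun e : OthersSignals N m × ℤˣ =>
      prescribed h m (combine m k e.1 m)) (b := prescribed h m k)
      (fun e _ => by rw [combine_self]) a e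
  obtain ⟨m, rfl⟩ : ∃ m' : {m // m ≠ n}, m = m' := ⟨⟨m, hmn⟩, rfl⟩
  by_cases hc : settled (record h) h m = false ∧ -1 ≤ recordSum (record h)
  · have hr : record h m = none := by simpa [settled] using (Bool.or_eq_false_iff.1 hc.1).1
    have key : ∀ e : OthersSignals N n × ℤˣ, (if prescribed h m (combine n k e.1 m) = a then
        privateCond p (record h) n k e else 0) =
        privateWeight p (record ((m.1, a) :: h)) n k e / ∑ v, valueWeight p (record h) n k v := by
      intro e
      rw [prescribed_eq_followSignal hc.1 hc.2, combine_other, record, if_pos hc,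
        ← privateWeight_update p hr]
      simp only [followSignal_eq_iff, privateCond, ite_div, zero_div]
    rw [observeProb]
    simp only [key]
    rw [← Finset.sum_div, sum_privateWeight, privateCond]
    have h1 := (sum_valueWeight_pos hp0 hp1 (record h) n k).ne'
    have h2 := (sum_valueWeight_pos hp0 hp1 (record ((m.1, a) :: h)) n k).ne'
    field_simp
  · have hr : record ((m.1, a) :: h) = record h := by rw [record, if_neg hc]
    obtain ⟨b, hb⟩ := prescribed_const hc
    rw [hr]
    refine ite_eq_sum_mul_of_const hsum (f := fun e : OthersSignals N n × ℤˣ =>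
      prescribed h m (combine n k e.1 m)) (b := b) (fun e he => hb _ ?_) a e
    rw [combine_other]
    exact eq_of_privateCond_ne_zero he m

/-- The predictive probability of the action of an unsettled player who follows her signal. -/
lemma observeProb_eq_predProb (hp0 : 0 < p) (hp1 : p < 1 / 2) {n m : Fin N} (hmn : m ≠ n)
    (k : ℤˣ) {h : Past N} (hm : settled (record h) h m = false) (hy : -1 ≤ recordSum (record h))
    (a : Bool) :
    observeProb p n k h m a = predProb p (privateExp (record h) n k) (actionSignal a) := by
  obtain ⟨m, rfl⟩ : ∃ m' : {m // m ≠ n}, m = m' := ⟨⟨m, hmn⟩, rfl⟩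
  have hr : record h m = none := by simpa [settled] using (Bool.or_eq_false_iff.1 hm).1
  have key : ∀ e : OthersSignals N n × ℤˣ, (if prescribed h m (combine n k e.1 m) = a then
      privateCond p (record h) n k e else 0) =
      privateWeight p (Function.update (record h) m (some (actionSignal a))) n k e /
        ∑ v, valueWeight p (record h) n k v := by
    intro e
    rw [prescribed_eq_followSignal hm hy, combine_other, ← privateWeight_update p hr]
    simp only [followSignal_eq_iff, privateCond, ite_div, zero_div]
  rw [observeProb]
  simp only [key]
  rw [← Finset.sum_div, sum_privateWeight, sum_signals, sum_signals, valueWeight_update p hr,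
    valueWeight_update p hr, valueWeight_one_eq hp0 hp1, predProb]
  have h1 := valueWeight_pos hp0 hp1 (record h) n k (-1)
  have h2 : 0 < odds p ^ privateExp (record h) n k := zpow_pos (odds_pos hp0 hp1) _
  have h3 : valueWeight p (record h) n k (-1) * odds p ^ privateExp (record h) n k +
    valueWeight p (record h) n k (-1) ≠ 0 := by positivity
  field_simp
  ring

/-! ### The law of the acting players and finite horizons -/

lemma measurable_cons : Measurable (fun c : Fin N × (ℕ → Fin N) =>
    fun k => (Nat.casesOn k c.1 c.2 : Fin N)) := by
  refine measurable_pi_lambda _ fun k => ?_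
  cases k with
  | zero => exact measurable_fst
  | succ k => exact (measurable_pi_apply k).comp measurable_snd

lemma measurable_uncons : Measurable (fun ω : ℕ → Fin N => (ω 0, fun k => ω (k + 1))) :=
  (measurable_pi_apply 0).prodMk (measurable_pi_lambda _ fun k => measurable_pi_apply (k + 1))

section Law

variable [NeZero N]

instance : IsProbabilityMeasure (actorLaw N) := by unfold actorLaw; infer_instance

/-- Prefixing a uniform player to a sequence of law `actorLaw` gives a sequence of law
`actorLaw`. -/
lemma map_cons_actorLaw :
    ((PMF.uniformOfFintype (Fin N)).toMeasure.prod (actorLaw N)).map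
      (fun c : Fin N × (ℕ → Fin N) => fun k => Nat.casesOn k c.1 c.2) = actorLaw N := by
  refine Measure.eq_infinitePi _ fun s t ht => ?_
  -- Both sides depend on a box with finitely many constraints, which are padded to `range (K + 1)`.
  classical
  obtain ⟨K, hK⟩ : ∃ K, s ⊆ Finset.range (K + 1) :=
    ⟨s.sup id, fun i hi => Finset.mem_range_succ_iff.2 (Finset.le_sup (f := id) hi)⟩
  set t' : ℕ → Set (Fin N) := fun i => if i ∈ s then t i else Set.univ with ht'
  have h1 : (fun c : Fin N × (ℕ → Fin N) => fun k => (Nat.casesOn k c.1 c.2 : Fin N)) ⁻¹'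
      (Set.pi s t) = t' 0 ×ˢ Set.pi (Finset.range K) (fun i => t' (i + 1)) := by
    ext ⟨j, ω⟩
    simp only [Set.mem_preimage, Set.mem_pi, Set.mem_prod, ht', Finset.mem_coe,
      Finset.mem_range]
    constructor
    · intro h
      refine ⟨?_, fun i _ => ?_⟩
      · split_ifs with h0
        · exact h 0 h0
        · trivial
      · split_ifs with h0
        · exact h (i + 1) h0
        · trivial
    · rintro ⟨h0, h⟩ i hi
      cases i with
      | zero => simpa [hi] using h0
      | succ i =>
        have := h i (by have := Finset.mem_range.1 (hK hi); omega)
        simpa [hi] using this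
  rw [Measure.map_apply measurable_cons
      (.pi s.countable_toSet fun i _ => Set.toFinite _ |>.measurableSet),
    h1, Measure.prod_prod, actorLaw,
    Measure.infinitePi_pi _ fun i _ => Set.toFinite _ |>.measurableSet]
  rw [Finset.prod_congr rfl fun i (hi : i ∈ s) => show
      (PMF.uniformOfFintype (Fin N)).toMeasure (t i) =
        (PMF.uniformOfFintype (Fin N)).toMeasure (t' i) by simp [ht', hi],
    Finset.prod_subset hK (fun i _ hi => by simp [ht', hi]), Finset.prod_range_succ', mul_comm]

lemma integral_actorLaw {F : Fin N → (ℕ → Fin N) → ℝ}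
    (hF : ∀ j, Measurable (F j)) {C : ℝ} (hC : ∀ j ω, ‖F j ω‖ ≤ C) :
    ∫ ω, F (ω 0) (fun k => ω (k + 1)) ∂actorLaw N = (1 / N) * ∑ j, ∫ ω, F j ω ∂actorLaw N := by
  have hF' : Measurable (Function.uncurry F) := measurable_from_prod_countable_right hF
  have hint : Integrable (Function.uncurry F)
      ((PMF.uniformOfFintype (Fin N)).toMeasure.prod (actorLaw N)) :=
    Integrable.of_bound hF'.aestronglyMeasurable C (.of_forall fun c => hC c.1 c.2)
  conv_lhs => rw [← map_cons_actorLaw]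
  refine (integral_map measurable_cons.aemeasurable
    (f := fun ω => Function.uncurry F (ω 0, fun k => ω (k + 1)))
    (hF'.comp measurable_uncons).aestronglyMeasurable).trans ?_
  refine (integral_prod (Function.uncurry F) hint).trans ?_
  rw [PMF.integral_eq_sum]
  simp [Finset.mul_sum]

end Law

/-! ### Expected purchases within a finite horizon -/

lemma ind_nonneg (c : Bool) : 0 ≤ ind c := by cases c <;> simp [ind]
lemma cast_toNat (c : Bool) : ((c.toNat : ℕ) : ℝ) = ind c := by cases c <;> simp [ind]

/-- The number of purchases of player `n` in the next `K` turns. -/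
noncomputable def purchases (σ : Fin N → Strategy N) (n : Fin N) (x : Fin N → ℤˣ) (K : ℕ)
    (h : Past N) (m : Fin N) (ω : ℕ → Fin N) : ℝ :=
  ∑ k ∈ Finset.range K, ind (σ n (x n) (play σ x h m ω k).1 (play σ x h m ω k).2)

lemma play_succ (σ : Fin N → Strategy N) (x : Fin N → ℤˣ) (h : Past N) (m : Fin N)
    (ω : ℕ → Fin N) (k : ℕ) :
    play σ x h m ω (k + 1) =
      play σ x ((m, σ m (x m) h m) :: h) (ω 0) (fun k => ω (k + 1)) k := by
  induction k with
  | zero => rfl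
  | succ k ih => rw [play, ih]; rfl

lemma purchases_succ (σ : Fin N → Strategy N) (n : Fin N) (x : Fin N → ℤˣ) (K : ℕ) (h : Past N)
    (m : Fin N) (ω : ℕ → Fin N) :
    purchases σ n x (K + 1) h m ω = ind (σ n (x n) h m) +
      purchases σ n x K ((m, σ m (x m) h m) :: h) (ω 0) (fun k => ω (k + 1)) := by
  rw [purchases, Finset.sum_range_succ', add_comm]
  simp only [play_succ, purchases]
  rfl

lemma purchases_nonneg (σ : Fin N → Strategy N) (n : Fin N) (x : Fin N → ℤˣ) (K : ℕ) (h : Past N)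
    (m : Fin N) (ω : ℕ → Fin N) : 0 ≤ purchases σ n x K h m ω :=
  Finset.sum_nonneg fun _ _ => ind_nonneg _

lemma bought_cons (c : Fin N × Bool) (h : Past N) (n : Fin N) :
    bought (c :: h) n = (decide (c = (n, true)) || bought h n) := by
  simp [bought, eq_comm]

/-- Under a feasible strategy a player buys at most once. -/
lemma purchases_le {σ : Fin N → Strategy N} {n : Fin N} (hσ : Feasible n (σ n))
    (x : Fin N → ℤˣ) (K : ℕ) (h : Past N) (m : Fin N) (ω : ℕ → Fin N) :
    purchases σ n x K h m ω ≤ if bought h n then 0 else 1 := by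
  induction K generalizing h m ω with
  | zero => rw [purchases, Finset.sum_range_zero]; split_ifs <;> norm_num
  | succ K ih =>
    rw [purchases_succ]
    have ih := ih ((m, σ m (x m) h m) :: h) (ω 0) (fun k => ω (k + 1))
    cases hb : σ n (x n) h m with
    | true =>
      obtain ⟨rfl, hn⟩ := hσ _ _ _ hb
      rw [bought_cons, hb] at ih
      simp only [decide_true, Bool.true_or, if_true] at ih
      rw [hb, hn]
      simp only [ind, if_true, Bool.false_eq_true, if_false]
      linarith
    | false =>
      rw [bought_cons] at ih
      simp only [ind, Bool.false_eq_true, if_false, zero_add]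
      refine ih.trans ?_
      cases bought h n <;> simp
      split_ifs <;> norm_num

lemma measurable_play (σ : Fin N → Strategy N) (x : Fin N → ℤˣ) (h : Past N) (m : Fin N) (k : ℕ)
    {β : Type*} [MeasurableSpace β] (g : Past N × Fin N → β) :
    Measurable fun ω => g (play σ x h m ω k) := by
  let _ : MeasurableSpace (Past N) := ⊤
  suffices hm : Measurable fun ω => play σ x h m ω k from
    (measurable_of_countable g).comp hm
  induction k with
  | zero => exact measurable_const
  | succ k ih =>
    exact (measurable_of_countable fun c : (Past N × Fin N) × Fin N =>
      ((c.1.2, σ c.1.2 (x c.1.2) c.1.1 c.1.2) :: c.1.1, c.2)).comp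
        (ih.prodMk (measurable_pi_apply k))

lemma measurable_purchases (σ : Fin N → Strategy N) (n : Fin N) (x : Fin N → ℤˣ) (K : ℕ)
    (h : Past N) (m : Fin N) : Measurable (purchases σ n x K h m) :=
  Finset.measurable_fun_sum _ fun k _ =>
    measurable_play σ x h m k fun c => ind (σ n (x n) c.1 c.2)

section Horizon

variable [NeZero N]

/-- The expected number of purchases of player `n` in the next `K` turns, by recursion on the
first turn. -/
noncomputable def expPurchases (σ : Fin N → Strategy N) (n : Fin N) (x : Fin N → ℤˣ) :
    ℕ → Past N → Fin N → ℝ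
  | 0, _, _ => 0
  | K + 1, h, m => ind (σ n (x n) h m) +
      (1 / N) * ∑ j, expPurchases σ n x K ((m, σ m (x m) h m) :: h) j

lemma integral_purchases {σ : Fin N → Strategy N} {n : Fin N} (hσ : Feasible n (σ n))
    (x : Fin N → ℤˣ) (K : ℕ) (h : Past N) (m : Fin N) :
    ∫ ω, purchases σ n x K h m ω ∂actorLaw N = expPurchases σ n x K h m := by
  have bound : ∀ K h m ω, ‖purchases σ n x K h m ω‖ ≤ 1 := fun K h m ω => by
    rw [Real.norm_of_nonneg (purchases_nonneg ..)]
    exact (purchases_le hσ x K h m ω).trans (by split_ifs <;> norm_num)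
  induction K generalizing h m with
  | zero => simp [purchases, expPurchases]
  | succ K ih =>
    simp only [purchases_succ, expPurchases]
    have h1 := integral_actorLaw
      (F := fun j => purchases σ n x K ((m, σ m (x m) h m) :: h) j)
      (fun j => measurable_purchases ..) (fun j ω => bound K _ j ω)
    have hmeas : Measurable fun ω : ℕ → Fin N =>
        purchases σ n x K ((m, σ m (x m) h m) :: h) (ω 0) (fun k => ω (k + 1)) :=
      (measurable_from_prod_countable_right (f := fun c : Fin N × (ℕ → Fin N) =>
        purchases σ n x K ((m, σ m (x m) h m) :: h) c.1 c.2)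
        (fun j => measurable_purchases ..)).comp measurable_uncons
    rw [integral_add (integrable_const _)
      (Integrable.of_bound hmeas.aestronglyMeasurable 1 (.of_forall fun ω => bound K _ _ _)), h1]
    simp [ih]

/-- Without discounting, the reward-to-go is the limit of the expected rewards over finite
horizons: a player buys at most once, so dominated convergence applies. -/
lemma tendsto_rewardToGo {σ : Fin N → Strategy N} {n : Fin N} (hσ : Feasible n (σ n))
    (μn : PrivateBelief N n) (k : ℤˣ) (h : Past N) (m : Fin N) :
    Filter.Tendsto
      (fun K => ∑ e, μn e * (((e.2 : ℤ) : ℝ) * expPurchases σ n (combine n k e.1) K h m))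
      Filter.atTop (nhds (rewardToGo 1 σ n μn k h m)) := by
  refine tendsto_finsetSum _ fun e _ => Filter.Tendsto.const_mul _ ?_
  have hsum : ∀ ω, Filter.Tendsto (fun K => purchases σ n (combine n k e.1) K h m ω) Filter.atTop
      (nhds (∑' i, ind (σ n (combine n k e.1 n) (play σ (combine n k e.1) h m ω i).1
        (play σ (combine n k e.1) h m ω i).2))) := fun ω =>
    (summable_of_sum_range_le (fun _ => ind_nonneg _) fun K =>
      (purchases_le hσ (combine n k e.1) K h m ω).trans
        (by split_ifs <;> norm_num : _ ≤ (1 : ℝ))).hasSum.tendsto_sum_nat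
  simp only [one_pow, one_mul, tsum_mul_left, integral_const_mul]
  refine Filter.Tendsto.const_mul _ ?_
  simp only [← integral_purchases hσ]
  have := tendsto_integral_of_dominated_convergence (μ := actorLaw N) (fun _ => (1 : ℝ))
    (fun K => (measurable_purchases σ n (combine n k e.1) K h m).aestronglyMeasurable)
    (integrable_const _)
    (fun K => .of_forall fun ω => by
      rw [Real.norm_of_nonneg (purchases_nonneg ..)]
      exact (purchases_le hσ _ K h m ω).trans (by split_ifs <;> norm_num))
    (.of_forall hsum)
  simpa only [combine_self] using this

end Horizon

/-! ### The value functions -/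

lemma predProb_nonneg (hp0 : 0 < p) (hp1 : p < 1 / 2) (k : ℤ) (x : ℤˣ) : 0 ≤ predProb p k x := by
  have h1 := signalProb_pos hp0 hp1 x 1
  have h2 := signalProb_pos hp0 hp1 x (-1)
  have h3 : 0 < odds p ^ k := zpow_pos (odds_pos hp0 hp1) _
  unfold predProb; positivity

lemma sum_predProb (hp0 : 0 < p) (hp1 : p < 1 / 2) (k : ℤ) : ∑ x, predProb p k x = 1 := by
  have h3 : 0 < odds p ^ k := zpow_pos (odds_pos hp0 hp1) _
  have h4 : 1 + odds p ^ k ≠ 0 := by positivity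
  simp only [predProb]
  rw [← Finset.sum_div, Finset.sum_add_distrib, ← Finset.sum_mul, sum_signalProb, sum_signalProb,
    one_mul, div_self h4]

lemma sum_predProb_mul_const (hp0 : 0 < p) (hp1 : p < 1 / 2) (k : ℤ) (c : ℝ) :
    ∑ x, predProb p k x * c = c := by
  rw [← Finset.sum_mul, sum_predProb hp0 hp1, one_mul]

lemma buyReward_zero (p : ℝ) : buyReward p 0 = 0 := by simp [buyReward]

lemma buyReward_nonneg (hp0 : 0 < p) (hp1 : p < 1 / 2) {k : ℤ} (hk : 0 ≤ k) :
    0 ≤ buyReward p k := by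
  have := one_le_zpow₀ (one_lt_odds hp0 hp1).le hk
  unfold buyReward
  exact div_nonneg (by linarith) (by linarith)

lemma buyReward_nonpos (hp0 : 0 < p) (hp1 : p < 1 / 2) {k : ℤ} (hk : k ≤ 0) :
    buyReward p k ≤ 0 := by
  have h1 := zpow_le_one_of_nonpos₀ (one_lt_odds hp0 hp1).le hk
  have h2 : 0 < odds p ^ k := zpow_pos (odds_pos hp0 hp1) _
  unfold buyReward
  exact div_nonpos_of_nonpos_of_nonneg (by linarith) (by linarith)

lemma buyReward_le_one (hp0 : 0 < p) (hp1 : p < 1 / 2) (k : ℤ) : buyReward p k ≤ 1 := by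
  have h2 : 0 < odds p ^ k := zpow_pos (odds_pos hp0 hp1) _
  unfold buyReward
  rw [div_le_one (by linarith)]; linarith

/-- The expected value of the product is a martingale under the revelation of a further signal. -/
lemma sum_predProb_mul_buyReward (hp0 : 0 < p) (hp1 : p < 1 / 2) (k : ℤ) :
    ∑ x : ℤˣ, predProb p k x * buyReward p (k + (x : ℤ)) = buyReward p k := by
  have hq := odds_pos hp0 hp1
  have h2 : 0 < odds p ^ k := zpow_pos hq _
  have h1p : 0 < 1 - p := by linarith
  rw [sum_signals]
  simp only [Units.val_one, Units.val_neg, buyReward, predProb, zpow_add₀ hq.ne', zpow_neg,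
    zpow_one, signalProb]
  generalize odds p ^ k = Q at h2
  rw [show (odds p) = (1 - p) / p from rfl]
  have e1 : Q * (1 - p) + p ≠ 0 := by positivity
  have e2 : Q * p + (1 - p) ≠ 0 := by positivity
  have e3 : Q + 1 ≠ 0 := by positivity
  have e4 : 1 + Q ≠ 0 := by positivity
  -- The odds `Q q` and `Q / q` after a further signal, with the inner fractions cleared.
  rw [show (Q * ((1 - p) / p) - 1) / (Q * ((1 - p) / p) + 1) =
      (Q * (1 - p) - p) / (Q * (1 - p) + p) by field_simp,
    show (Q * ((1 - p) / p)⁻¹ - 1) / (Q * ((1 - p) / p)⁻¹ + 1) =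
      (Q * p - (1 - p)) / (Q * p + (1 - p)) by field_simp]
  norm_num
  field_simp
  ring

/-- The expected reward of a player with signal `x` who has revealed `-1` and may buy at any time,
when `d` signals are still to be revealed and the sum is `y`.  Signals are revealed as long as
`y ≥ -1`; once `y ≤ -2`, the expected value of the product is at most `0` for her. -/
noncomputable def revealedValue (p : ℝ) (x : ℤˣ) : ℕ → ℤ → ℝ
  | 0, y => max (buyReward p (y + 1 + (x : ℤ))) 0
  | d + 1, y => if y ≤ -2 then 0 else
      ∑ u : ℤˣ, predProb p (y + 1 + (x : ℤ)) u * revealedValue p x d (y + (u : ℤ))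

/-- The expected reward, before the acting player is drawn, of a player with signal `x` who has
neither revealed nor bought, when `d` players (herself included) are in this position.  With equal
probability the first of them to act is she, who buys or reveals `-1`, or one of the others. -/
noncomputable def hiddenValue (p : ℝ) (x : ℤˣ) : ℕ → ℤ → ℝ
  | 0, _ => 0
  | d + 1, y => if y ≤ -2 then 0 else
      ((if x = 1 then buyReward p (y + 1) else revealedValue p x d (y - 1)) +
        d * ∑ u : ℤˣ, predProb p (y + (x : ℤ)) u * hiddenValue p x d (y + (u : ℤ))) / (d + 1)

lemma units_cast_bounds (x : ℤˣ) : -1 ≤ (x : ℤ) ∧ (x : ℤ) ≤ 1 := by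
  rcases Int.units_eq_one_or x with rfl | rfl <;> simp

lemma revealedValue_of_le (hp0 : 0 < p) (hp1 : p < 1 / 2) (x : ℤˣ) (d : ℕ) {y : ℤ}
    (hy : y ≤ -2) : revealedValue p x d y = 0 := by
  have := units_cast_bounds x
  cases d with
  | zero => exact max_eq_right (buyReward_nonpos hp0 hp1 (by omega))
  | succ d => exact if_pos hy

lemma revealedValue_nonneg (hp0 : 0 < p) (hp1 : p < 1 / 2) (x : ℤˣ) (d : ℕ) (y : ℤ) :
    0 ≤ revealedValue p x d y := by
  induction d generalizing y with
  | zero => exact le_max_right _ _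
  | succ d ih =>
    rw [revealedValue]; split_ifs
    · exact le_rfl
    · exact Finset.sum_nonneg fun u _ => mul_nonneg (predProb_nonneg hp0 hp1 _ _) (ih _)

lemma revealedValue_le_one (hp0 : 0 < p) (hp1 : p < 1 / 2) (x : ℤˣ) (d : ℕ) (y : ℤ) :
    revealedValue p x d y ≤ 1 := by
  induction d generalizing y with
  | zero => exact max_le (buyReward_le_one hp0 hp1 _) zero_le_one
  | succ d ih =>
    rw [revealedValue]; split_ifs
    · exact zero_le_one
    · refine le_of_le_of_eq (Finset.sum_le_sum fun u _ =>
        mul_le_mul_of_nonneg_left (ih _) (predProb_nonneg hp0 hp1 _ _)) ?_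
      exact sum_predProb_mul_const hp0 hp1 _ _

/-- Waiting for the remaining signals is at least as good as buying at once. -/
lemma buyReward_le_revealedValue (hp0 : 0 < p) (hp1 : p < 1 / 2) (x : ℤˣ) (d : ℕ) (y : ℤ) :
    buyReward p (y + 1 + (x : ℤ)) ≤ revealedValue p x d y := by
  have := units_cast_bounds x
  induction d generalizing y with
  | zero => exact le_max_left _ _
  | succ d ih =>
    rw [revealedValue]; split_ifs with hy
    · exact buyReward_nonpos hp0 hp1 (by omega)
    · rw [← sum_predProb_mul_buyReward hp0 hp1]
      refine Finset.sum_le_sum fun u _ =>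
        mul_le_mul_of_nonneg_left ?_ (predProb_nonneg hp0 hp1 _ _)
      refine le_of_eq_of_le ?_ (ih _)
      congr 1; ring

/-- With signal `1`, the odds of a player who has revealed `-1` never fall below one, so the
option to wait has no value. -/
lemma revealedValue_one (hp0 : 0 < p) (hp1 : p < 1 / 2) (d : ℕ) {y : ℤ} (hy : -2 ≤ y) :
    revealedValue p 1 d y = buyReward p (y + 2) := by
  induction d generalizing y with
  | zero =>
    rw [revealedValue, Units.val_one, add_assoc]
    exact max_eq_left (buyReward_nonneg hp0 hp1 (by omega))
  | succ d ih =>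
    rw [revealedValue]; split_ifs with h
    · rw [show y + 2 = 0 by omega, buyReward_zero]
    · rw [← sum_predProb_mul_buyReward hp0 hp1]
      refine Finset.sum_congr rfl fun u _ => ?_
      have := units_cast_bounds u
      rw [ih (by omega), Units.val_one]
      ring_nf

lemma hiddenValue_of_le (x : ℤˣ) (d : ℕ) {y : ℤ} (hy : y ≤ -2) : hiddenValue p x d y = 0 := by
  cases d with
  | zero => rfl
  | succ d => exact if_pos hy

lemma hiddenValue_nonneg (hp0 : 0 < p) (hp1 : p < 1 / 2) (x : ℤˣ) (d : ℕ) (y : ℤ) :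
    0 ≤ hiddenValue p x d y := by
  induction d generalizing y with
  | zero => exact le_rfl
  | succ d ih =>
    rw [hiddenValue]; split_ifs with h1 h2
    · exact le_rfl
    · have := buyReward_nonneg hp0 hp1 (k := y + 1) (by omega)
      have := Finset.sum_nonneg fun (u : ℤˣ) (_ : u ∈ Finset.univ) =>
        mul_nonneg (predProb_nonneg hp0 hp1 (y + (x : ℤ)) u) (ih (y + (u : ℤ)))
      positivity
    · have := revealedValue_nonneg hp0 hp1 x d (y - 1)
      have := Finset.sum_nonneg fun (u : ℤˣ) (_ : u ∈ Finset.univ) =>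
        mul_nonneg (predProb_nonneg hp0 hp1 (y + (x : ℤ)) u) (ih (y + (u : ℤ)))
      positivity

lemma hiddenValue_le_one (hp0 : 0 < p) (hp1 : p < 1 / 2) (x : ℤˣ) (d : ℕ) (y : ℤ) :
    hiddenValue p x d y ≤ 1 := by
  induction d generalizing y with
  | zero => exact zero_le_one
  | succ d ih =>
    rw [hiddenValue]; split_ifs with h1
    · exact zero_le_one
    all_goals
      have hs : ∑ u : ℤˣ, predProb p (y + (x : ℤ)) u * hiddenValue p x d (y + (u : ℤ)) ≤ 1 :=
        le_of_le_of_eq (Finset.sum_le_sum fun u _ =>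
          mul_le_mul_of_nonneg_left (ih _) (predProb_nonneg hp0 hp1 _ _))
          (sum_predProb_mul_const hp0 hp1 _ _)
      have hd : (0 : ℝ) ≤ d := Nat.cast_nonneg d
      have hb := buyReward_le_one hp0 hp1 (y + 1)
      have hr := revealedValue_le_one hp0 hp1 x d (y - 1)
      rw [div_le_one (by positivity)]
      nlinarith

/-- The expected reward of a player who has not bought, before the acting player is drawn, in the
state `(r, y, w)`. -/
noncomputable def exAnte (N : ℕ) (p : ℝ) (r : Bool) (x : ℤˣ) (y : ℤ) (w : ℕ) : ℝ :=
  if r then revealedValue p x (N - w) y else hiddenValue p x (N - w) y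

/-- The value of the acting player under the patient profile. -/
noncomputable def actValue (N : ℕ) (p : ℝ) (x : ℤˣ) (r : Bool) (y : ℤ) (w : ℕ) : ℝ :=
  let γ := patientProfile N r y w
  if γ x then buyReward p (y + r.toNat + (x : ℤ))
  else exAnte N p (Gr r γ) x (Gy r y γ false) (Gw r w γ false)

/-- The value of a player who does not act while the acting player has (`z = 1`) or has not
(`z = 0`) revealed or bought. -/
noncomputable def watchValue (N : ℕ) (p : ℝ) (r : Bool) (x : ℤˣ) (z : Bool) (y : ℤ) (w : ℕ) : ℝ :=
  if z = true ∨ y ≤ -2 then exAnte N p r x y w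
  else ∑ u : ℤˣ, predProb p (y + r.toNat + (x : ℤ)) u * exAnte N p r x (y + (u : ℤ)) (w + 1)

lemma exAnte_nonneg (hp0 : 0 < p) (hp1 : p < 1 / 2) (r : Bool) (x : ℤˣ) (y : ℤ) (w : ℕ) :
    0 ≤ exAnte N p r x y w := by
  unfold exAnte; split_ifs
  · exact revealedValue_nonneg hp0 hp1 _ _ _
  · exact hiddenValue_nonneg hp0 hp1 _ _ _

lemma exAnte_le_one (hp0 : 0 < p) (hp1 : p < 1 / 2) (r : Bool) (x : ℤˣ) (y : ℤ) (w : ℕ) :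
    exAnte N p r x y w ≤ 1 := by
  unfold exAnte; split_ifs
  · exact revealedValue_le_one hp0 hp1 _ _ _
  · exact hiddenValue_le_one hp0 hp1 _ _ _

lemma exAnte_of_le (hp0 : 0 < p) (hp1 : p < 1 / 2) (r : Bool) (x : ℤˣ) {y : ℤ} (hy : y ≤ -2)
    (w : ℕ) : exAnte N p r x y w = 0 := by
  unfold exAnte; split_ifs
  · exact revealedValue_of_le hp0 hp1 _ _ hy
  · exact hiddenValue_of_le _ _ hy

lemma actValue_of_le (hp0 : 0 < p) (hp1 : p < 1 / 2) (x : ℤˣ) (r : Bool) {y : ℤ} (hy : y ≤ -2)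
    (w : ℕ) : actValue N p x r y w = 0 := by
  simp [actValue, patientProfile, hy, neverBuy, Gy, show ¬ neverBuy = followSignal from
    followSignal_ne_neverBuy.symm, exAnte_of_le hp0 hp1]

/-- An unrevealed acting player with signal `1` buys. -/
lemma actValue_hidden_one {y : ℤ} (hy : -1 ≤ y) {w : ℕ} (hw : w < N) :
    actValue N p 1 false y w = buyReward p (y + 1) := by
  simp [actValue, patientProfile, show ¬ y ≤ -2 by omega, hw, followSignal]

/-- An unrevealed acting player with signal `-1` waits and thereby reveals her signal. -/
lemma actValue_hidden_neg_one {y : ℤ} (hy : -1 ≤ y) {w : ℕ} (hw : w < N) :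
    actValue N p (-1) false y w = exAnte N p true (-1) (y - 1) (w + 1) := by
  simp [actValue, patientProfile, show ¬ y ≤ -2 by omega, hw, followSignal, Gr, Gz, Gy, Gw,
    sub_eq_add_neg]

/-- Once her signal is revealed, the turn of a player does not change her expected reward. -/
lemma actValue_revealed (hp0 : 0 < p) (hp1 : p < 1 / 2) (x : ℤˣ) (y : ℤ) {w : ℕ} (hw : w ≤ N) :
    actValue N p x true y w = exAnte N p true x y w := by
  by_cases hy : y ≤ -2
  · rw [actValue_of_le hp0 hp1 _ _ hy, exAnte_of_le hp0 hp1 _ _ hy]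
  by_cases hx : patientProfile N true y w x = true
  · rw [actValue, if_pos hx, exAnte, if_pos rfl]
    rcases Int.units_eq_one_or x with rfl | rfl
    · rw [revealedValue_one hp0 hp1 _ (by omega), Units.val_one]
      congr 1; simp; ring
    · have hw' : w = N ∧ 1 ≤ y := by
        simp only [patientProfile, if_neg hy] at hx
        split_ifs at hx with h1 h2
        · simp [followSignal] at hx
        · exact ⟨by omega, h2.2⟩
        · simp [followSignal] at hx
      obtain ⟨rfl, hy1⟩ := hw'
      rw [Nat.sub_self, revealedValue]
      exact (max_eq_left (buyReward_nonneg hp0 hp1 (by simp; omega))).symm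
  · rw [actValue, if_neg hx]
    simp [Gr, Gy, Gw, Gz]

/-- The value before the draw is the average of the values after the draw. -/
lemma card_mul_exAnte (hp0 : 0 < p) (hp1 : p < 1 / 2) (x : ℤˣ) (r : Bool) (y : ℤ) (w : ℕ)
    (h1 : r.toNat ≤ w) (h2 : w + 1 ≤ N + r.toNat) :
    N * exAnte N p r x y w = actValue N p x r y w + ((w : ℝ) - ind r) * watchValue N p r x true y w
      + ((N : ℝ) - w - 1 + ind r) * watchValue N p r x false y w := by
  by_cases hy : y ≤ -2
  · simp [watchValue, hy, exAnte_of_le hp0 hp1, actValue_of_le hp0 hp1]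
  cases r with
  | true =>
    simp only [Bool.toNat_true] at h1 h2
    rw [actValue_revealed hp0 hp1 x y (by omega)]
    have hw : (N : ℝ) - w = 0 ∨ watchValue N p true x false y w = exAnte N p true x y w := by
      by_cases hN : w = N
      · left; rw [hN, sub_self]
      · right
        obtain ⟨d, hd⟩ : ∃ d, N - w = d + 1 := ⟨N - w - 1, by omega⟩
        have hd' : N - (w + 1) = d := by omega
        simp [watchValue, hy, exAnte, hd, hd', revealedValue]
    have hw' : ((N : ℝ) - w) * watchValue N p true x false y w =
        ((N : ℝ) - w) * exAnte N p true x y w := by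
      rcases hw with h | h
      · rw [h, zero_mul, zero_mul]
      · rw [h]
    have hz : watchValue N p true x true y w = exAnte N p true x y w := if_pos (Or.inl rfl)
    rw [hz]
    simp only [ind, if_true]
    linear_combination -hw'
  | false =>
    simp only [Bool.toNat_false] at h1 h2
    obtain ⟨d, hd⟩ : ∃ d, N - w = d + 1 := ⟨N - w - 1, by omega⟩
    have hd' : N - (w + 1) = d := by omega
    have hN : (N : ℝ) = w + d + 1 := by
      rw [show N = w + d + 1 by omega]; push_cast; ring
    have hz : watchValue N p false x true y w = exAnte N p false x y w := if_pos (Or.inl rfl)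
    have ha : actValue N p x false y w =
        if x = 1 then buyReward p (y + 1) else revealedValue p x d (y - 1) := by
      rcases Int.units_eq_one_or x with rfl | rfl
      · rw [actValue_hidden_one (by omega) (by omega), if_pos rfl]
      · rw [actValue_hidden_neg_one (by omega) (by omega), if_neg (by decide), exAnte, if_pos rfl,
          hd']
    have he : (d + 1) * exAnte N p false x y w = actValue N p x false y w +
        d * watchValue N p false x false y w := by
      have hd0 : (d : ℝ) + 1 ≠ 0 := by positivity
      rw [ha]
      simp only [watchValue, hy, exAnte, hd, hd', hiddenValue, Bool.false_eq_true, or_self,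
        if_false, Bool.toNat_false, Nat.cast_zero, add_zero]
      rw [mul_div_cancel₀ _ hd0]
    rw [hz, hN]
    simp only [ind, Bool.false_eq_true, if_false]
    linear_combination he

/-- The value of waiting is the value before the next draw. -/
lemma waitReward_eq (hN : N ≠ 0) (hp0 : 0 < p) (hp1 : p < 1 / 2) (x : ℤˣ) (r : Bool) (y : ℤ)
    (w : ℕ) (h1 : r.toNat ≤ w) (h2 : w + 1 ≤ N + r.toNat) :
    waitReward N 1 (patientProfile N) (actValue N p) (watchValue N p) x r y w =
      exAnte N p (Gr r (patientProfile N r y w)) x (Gy r y (patientProfile N r y w) false)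
        (Gw r w (patientProfile N r y w) false) := by
  have hN' : (N : ℝ) ≠ 0 := Nat.cast_ne_zero.2 hN
  set γ := patientProfile N r y w with hγ
  have hr : (Gr r γ).toNat ≤ Gw r w γ false ∧ Gw r w γ false + 1 ≤ N + (Gr r γ).toNat ∧
      ((Gw r w γ false : ℕ) : ℝ) - ind (Gr r γ) = w - ind r := by
    unfold Gw Gr Gz
    cases r <;> by_cases h : γ = followSignal <;> simp_all [ind]
  have := card_mul_exAnte hp0 hp1 x (Gr r γ) (Gy r y γ false) (Gw r w γ false) hr.1 hr.2.1
  have e : (N : ℝ) - w - 1 + ind r = N - Gw r w γ false - 1 + ind (Gr r γ) := by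
    linear_combination hr.2.2
  rw [waitReward]
  simp only [← hγ]
  rw [e, ← hr.2.2]
  field_simp
  linear_combination -this

lemma actValue_optimal (hp0 : 0 < p) (hp1 : p < 1 / 2) (x : ℤˣ) (r : Bool) (y : ℤ) (w : ℕ)
    (h1 : r.toNat ≤ w) (h2 : w + 1 ≤ N + r.toNat) :
    let γ := patientProfile N r y w
    let A := exAnte N p (Gr r γ) x (Gy r y γ false) (Gw r w γ false)
    (γ x = true → A ≤ buyReward p (y + r.toNat + (x : ℤ))) ∧
      (γ x = false → buyReward p (y + r.toNat + (x : ℤ)) ≤ A) := by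
  intro γ A
  have hxb := units_cast_bounds x
  by_cases hy : y ≤ -2
  · have hγ : γ = neverBuy := if_pos hy
    refine ⟨fun h => absurd h (by simp [hγ, neverBuy]), fun _ => ?_⟩
    refine le_trans (buyReward_nonpos hp0 hp1 ?_) (exAnte_nonneg hp0 hp1 _ _ _ _)
    have := Bool.toNat_le r
    omega
  cases r with
  | true =>
    have hA : A = exAnte N p true x y w := by simp [A, Gr, Gy, Gw, Gz]
    have hr : buyReward p (y + (true : Bool).toNat + (x : ℤ)) ≤ A := by
      rw [hA, exAnte, if_pos rfl]
      exact buyReward_le_revealedValue hp0 hp1 x _ y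
    refine ⟨fun h => ?_, fun _ => hr⟩
    simp only [Bool.toNat_true] at h1 h2
    have := actValue_revealed (N := N) hp0 hp1 x y (w := w) (by omega)
    rw [hA, ← this, actValue, if_pos h]
  | false =>
    simp only [Bool.toNat_false] at h1 h2
    have hγ : γ = followSignal := by
      simp only [γ, patientProfile, if_neg hy]
      exact if_pos (show w < N by omega)
    have hA : A = revealedValue p x (N - (w + 1)) (y - 1) := by
      simp [A, Gr, Gy, Gw, Gz, hγ, exAnte, sub_eq_add_neg]
    rw [hA, hγ]
    refine ⟨fun h => ?_, fun _ => ?_⟩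
    · obtain rfl : x = 1 := by simpa [followSignal] using h
      rw [revealedValue_one hp0 hp1 _ (by omega : -2 ≤ y - 1)]
      refine le_of_eq ?_
      congr 1; simp; ring
    · refine le_of_eq_of_le ?_ (buyReward_le_revealedValue hp0 hp1 x _ _)
      congr 1; simp

theorem solvesFPE_patientProfile (hN : N ≠ 0) (hp0 : 0 < p) (hp1 : p < 1 / 2) :
    SolvesFPE N p 1 (patientProfile N) := by
  refine ⟨actValue N p, watchValue N p, fun x r y w h1 h2 => ?_, fun r x z y w h1 h2 => ?_⟩
  · simp only [waitReward_eq hN hp0 hp1 x r y w h1 h2]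
    exact ⟨(actValue_optimal hp0 hp1 x r y w h1 h2).1, (actValue_optimal hp0 hp1 x r y w h1 h2).2,
      rfl⟩
  · have hN' : (N : ℝ) ≠ 0 := Nat.cast_ne_zero.2 hN
    intro γ
    have key : ∀ a y', (1 : ℝ) / N * actValue N p x r y' (Gw z w γ a)
          + 1 / N * watchValue N p r x (Gz z γ a) y' (Gw z w γ a)
          + 1 / N * ((w : ℝ) - ind z - ind r) * watchValue N p r x true y' (Gw z w γ a)
          + 1 / N * ((N : ℝ) - w - 2 + ind z + ind r) * watchValue N p r x false y' (Gw z w γ a)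
        = exAnte N p r x y' (Gw z w γ a) := by
      intro a y'
      have hw : r.toNat ≤ Gw z w γ a ∧ Gw z w γ a + 1 ≤ N + r.toNat ∧
          (Gw z w γ a : ℝ) = w + ind (Gz z γ a) - ind z := by
        unfold Gw
        have h3 : z.toNat ≤ (Gz z γ a).toNat := by
          unfold Gz; split_ifs with h
          · simp [h.1]
          · exact le_rfl
        have h4 := Bool.toNat_le (Gz z γ a)
        refine ⟨by omega, by omega, ?_⟩
        rw [Nat.cast_sub (by omega)]
        push_cast [cast_toNat]; ring
      have := card_mul_exAnte hp0 hp1 x r y' (Gw z w γ a) hw.1 hw.2.1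
      cases hz : Gz z γ a <;> rw [hz] at hw <;>
        simp only [ind, if_true, Bool.false_eq_true, if_false] at hw <;>
        · rw [hw.2.2] at this
          field_simp
          simp only [ind] at this ⊢
          linear_combination -this
    simp only [key]
    cases z with
    | true =>
      simp only [Gy, Gw, Gz, watchValue, Bool.true_eq_false, false_and, if_false, true_or, if_true,
        add_tsub_cancel_right]
      rw [sum_predProb_mul_const hp0 hp1]
    | false =>
      by_cases hy : y ≤ -2
      · have hγ : γ = neverBuy := if_pos hy
        have hne : γ ≠ followSignal := hγ ▸ followSignal_ne_neverBuy.symm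
        have hγx : ∀ u, γ u = false := fun u => by rw [hγ, neverBuy]
        simp [hγx, hne, Gy, Gw, Gz, watchValue, hy, exAnte_of_le hp0 hp1]
      · have hr := Bool.toNat_le r
        simp only [Bool.toNat_false] at h1 h2
        have hγ : γ = followSignal := by
          simp only [γ, patientProfile, if_neg hy]
          exact if_pos (show w < N by omega)
        rw [hγ, watchValue, if_neg (by simpa using hy)]
        refine Finset.sum_congr rfl fun u _ => ?_
        congr 2
        · rcases Int.units_eq_one_or u with rfl | rfl <;> simp [Gy, followSignal]
        · simp [Gw, Gz]

/-! ### The state of the game from the viewpoint of one player -/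

/-- Only buying reveals the signal `1`. -/
lemma bought_of_record_eq_one {h : Past N} {n : Fin N} (hr : record h n = some 1) :
    bought h n = true := by
  induction h with
  | nil => simp [record] at hr
  | cons c h ih =>
    obtain ⟨m, a⟩ := c
    rw [bought_cons]
    rw [record] at hr
    split_ifs at hr with hc
    · by_cases hmn : n = m
      · subst hmn
        rw [Function.update_self] at hr
        cases a
        · exact absurd hr (by decide)
        · simp
      · rw [Function.update_of_ne hmn] at hr
        rw [ih hr, Bool.or_true]
    · rw [ih hr, Bool.or_true]

lemma settled_of_not_bought {h : Past N} {n : Fin N} (hn : bought h n = false) :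
    settled (record h) h n = (record h n).isSome := by rw [settled, hn, Bool.or_false]

lemma privateExp_eq {h : Past N} {n : Fin N} (hn : bought h n = false) (x : ℤˣ) :
    privateExp (record h) n x =
      recordSum (record h) + (record h n).isSome.toNat + (x : ℤ) := by
  have h1 : shown (record h n) = -((record h n).isSome.toNat : ℤ) := by
    cases hr : record h n with
    | none => rfl
    | some u =>
      rcases Int.units_eq_one_or u with rfl | rfl
      · rw [bought_of_record_eq_one hr] at hn; cases hn
      · rfl
  have h2 : recordSum (record h) =
      shown (record h n) + ∑ m : {m // m ≠ n}, shown (record h m) :=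
    Fintype.sum_eq_add_sum_subtype_ne _ n
  rw [privateExp, h2, h1]; ring

lemma record_cons_of_ne {h : Past N} {m i : Fin N} (hi : i ≠ m) (a : Bool) :
    record ((m, a) :: h) i = record h i := by
  rw [record]; split_ifs
  · rw [Function.update_of_ne hi]
  · rfl

lemma settled_cons_of_ne {h : Past N} {m i : Fin N} (hi : i ≠ m) (a : Bool) :
    settled (record ((m, a) :: h)) ((m, a) :: h) i = settled (record h) h i := by
  rw [settled, settled, record_cons_of_ne hi, bought_cons]
  simp [Ne.symm hi]

lemma record_cons_of_settled {h : Past N} {m : Fin N}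
    (hm : settled (record h) h m = true ∨ recordSum (record h) ≤ -2) (a : Bool) :
    record ((m, a) :: h) = record h := by
  rw [record, if_neg]
  rintro ⟨h1, h2⟩
  rcases hm with hm | hm
  · rw [hm] at h1; cases h1
  · omega

lemma settledCount_cons_of_settled {h : Past N} {m : Fin N}
    (hm : settled (record h) h m = true) (a : Bool) :
    settledCount (record ((m, a) :: h)) ((m, a) :: h) = settledCount (record h) h := by
  have h1 : settled (record ((m, a) :: h)) ((m, a) :: h) m = true := by
    rw [settled, record_cons_of_settled (.inl hm), bought_cons]
    rw [settled, Bool.or_eq_true] at hm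
    rcases hm with hm | hm <;> simp [hm]
  rw [settledCount_eq _ _ m, settledCount_eq _ _ m, h1, hm]
  congr 1
  exact Finset.sum_congr rfl fun i _ => by rw [settled_cons_of_ne i.2]

lemma record_cons_of_not_settled {h : Past N} {m : Fin N}
    (hm : settled (record h) h m = false) (hy : -1 ≤ recordSum (record h)) (a : Bool) :
    record ((m, a) :: h) = Function.update (record h) m (some (actionSignal a)) := by
  rw [record, if_pos ⟨hm, hy⟩]

lemma recordSum_cons_of_not_settled {h : Past N} {m : Fin N}
    (hm : settled (record h) h m = false) (hy : -1 ≤ recordSum (record h)) (a : Bool) :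
    recordSum (record ((m, a) :: h)) = recordSum (record h) + (actionSignal a : ℤ) := by
  have hr : record h m = none := by simpa [settled] using (Bool.or_eq_false_iff.1 hm).1
  rw [recordSum, recordSum, Fintype.sum_eq_add_sum_subtype_ne _ m,
    Fintype.sum_eq_add_sum_subtype_ne (fun i => shown (record h i)) m, hr,
    Finset.sum_congr rfl fun (i : {i // i ≠ m}) _ => by rw [record_cons_of_ne i.2],
    record_cons_of_not_settled hm hy, Function.update_self, shown_some, shown_none]
  ring

lemma settledCount_cons_of_not_settled {h : Past N} {m : Fin N}
    (hm : settled (record h) h m = false) (hy : -1 ≤ recordSum (record h)) (a : Bool) :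
    settledCount (record ((m, a) :: h)) ((m, a) :: h) = settledCount (record h) h + 1 := by
  have h1 : settled (record ((m, a) :: h)) ((m, a) :: h) m = true := by
    rw [settled, record_cons_of_not_settled hm hy, Function.update_self]; rfl
  rw [settledCount_eq _ _ m, settledCount_eq (record h) h m, h1, hm,
    Finset.sum_congr rfl fun (i : {i // i ≠ m}) _ => by rw [settled_cons_of_ne i.2]]
  simp [add_comm]

/-- The expected reward of player `n` with signal `x` before the acting player is drawn. -/
noncomputable def stateValue (p : ℝ) (h : Past N) (n : Fin N) (x : ℤˣ) : ℝ :=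
  exAnte N p (record h n).isSome x (recordSum (record h)) (settledCount (record h) h)

/-- The expected reward of player `n` with signal `x` when `m` is the acting player. -/
noncomputable def turnValue (p : ℝ) (h : Past N) (n : Fin N) (x : ℤˣ) (m : Fin N) : ℝ :=
  if m = n then
    actValue N p x (record h n).isSome (recordSum (record h)) (settledCount (record h) h)
  else
    watchValue N p (record h n).isSome x (settled (record h) h m) (recordSum (record h))
      (settledCount (record h) h)

lemma state_admissible {h : Past N} {n : Fin N} (hn : bought h n = false) :
    (record h n).isSome.toNat ≤ settledCount (record h) h ∧
      settledCount (record h) h + 1 ≤ N + (record h n).isSome.toNat := by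
  have h1 := settledCount_eq (record h) h n
  have h2 := sum_others_settled_le (record h) h n
  rw [settled_of_not_bought hn] at h1
  omega

lemma sum_turnValue (hp0 : 0 < p) (hp1 : p < 1 / 2) {h : Past N} {n : Fin N}
    (hn : bought h n = false) (x : ℤˣ) :
    ∑ m, turnValue p h n x m = N * stateValue p h n x := by
  obtain ⟨h1, h2⟩ := state_admissible hn
  rw [stateValue, card_mul_exAnte hp0 hp1 x _ _ _ h1 h2,
    Fintype.sum_eq_add_sum_subtype_ne _ n, turnValue, if_pos rfl]
  generalize hr : (record h n).isSome = r at *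
  generalize hy : recordSum (record h) = y at *
  have hw : (settledCount (record h) h : ℝ) =
      ind r + ∑ i : {i // i ≠ n}, ind (settled (record h) h i) := by
    rw [settledCount_eq _ _ n, settled_of_not_bought hn, hr]
    push_cast
    simp only [cast_toNat]
  have hcard : (N : ℝ) = 1 + ∑ i : {i // i ≠ n}, 1 := by
    rw [← Fintype.sum_eq_add_sum_subtype_ne (fun _ : Fin N => (1 : ℝ)) n]; simp
  set f := fun z => watchValue N p r x z y (settledCount (record h) h) with hf
  have e : ∀ i : {i // i ≠ n}, turnValue p h n x i = f false * 1 +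
      (f true - f false) * ind (settled (record h) h i) := by
    intro i
    rw [turnValue, if_neg i.2, hr, hy]
    cases settled (record h) h i <;> simp [hf, ind]
  simp only [e]
  rw [Finset.sum_add_distrib, ← Finset.mul_sum, ← Finset.mul_sum]
  linear_combination (f true - f false) * (-hw) - f false * hcard

lemma isSome_record_cons_of_ne {h : Past N} {m n : Fin N} (hmn : m ≠ n) (a : Bool) :
    (record ((m, a) :: h) n).isSome = (record h n).isSome := by
  rw [record_cons_of_ne hmn.symm]

lemma stateValue_cons_of_settled (hp0 : 0 < p) (hp1 : p < 1 / 2) {h : Past N} {m : Fin N}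
    (hm : settled (record h) h m = true ∨ recordSum (record h) ≤ -2) (a : Bool) (n : Fin N)
    (x : ℤˣ) : stateValue p ((m, a) :: h) n x = stateValue p h n x := by
  unfold stateValue
  have hr := record_cons_of_settled hm a
  rw [hr]
  rcases hm with hm' | hm'
  · have := settledCount_cons_of_settled hm' a
    rw [hr] at this
    rw [this]
  · rw [exAnte_of_le hp0 hp1 _ _ hm', exAnte_of_le hp0 hp1 _ _ hm']

/-- The turn of another player leads, on average, to the value of watching it. -/
lemma sum_observeProb_mul_stateValue (hp0 : 0 < p) (hp1 : p < 1 / 2) {h : Past N} {m n : Fin N}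
    (hmn : m ≠ n) (hn : bought h n = false) (x : ℤˣ) :
    ∑ a, observeProb p n x h m a * stateValue p ((m, a) :: h) n x = turnValue p h n x m := by
  rw [turnValue, if_neg hmn, watchValue]
  by_cases hc : settled (record h) h m = true ∨ recordSum (record h) ≤ -2
  · simp only [stateValue_cons_of_settled hp0 hp1 hc]
    rw [if_pos hc, ← Finset.sum_mul, sum_observeProb hp0 hp1, one_mul, stateValue]
  · rw [if_neg hc]
    rw [not_or, Bool.not_eq_true] at hc
    have hy : -1 ≤ recordSum (record h) := by omega
    simp only [stateValue, observeProb_eq_predProb hp0 hp1 hmn x hc.1 hy,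
      recordSum_cons_of_not_settled hc.1 hy, settledCount_cons_of_not_settled hc.1 hy,
      isSome_record_cons_of_ne hmn, privateExp_eq hn]
    rw [sum_signals]
    simp [actionSignal]

/-- The turn in which player `n` waits leads to the value of waiting in the fixed-point
equation. -/
lemma stateValue_cons_self (hp0 : 0 < p) (hp1 : p < 1 / 2) {h : Past N} {n : Fin N}
    (hn : bought h n = false) (x : ℤˣ) :
    let γ := patientProfile N (record h n).isSome (recordSum (record h)) (settledCount (record h) h)
    stateValue p ((n, false) :: h) n x =
      exAnte N p (Gr (record h n).isSome γ) x
        (Gy (record h n).isSome (recordSum (record h)) γ false)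
        (Gw (record h n).isSome (settledCount (record h) h) γ false) := by
  intro γ
  have hs := settled_of_not_bought hn
  by_cases hy : recordSum (record h) ≤ -2
  · have hγ : γ ≠ followSignal := by
      rw [show γ = neverBuy from if_pos hy]; exact followSignal_ne_neverBuy.symm
    rw [stateValue_cons_of_settled hp0 hp1 (.inr hy)]
    simp [stateValue, Gy, hγ, exAnte_of_le hp0 hp1 _ _ hy]
  cases hr : (record h n).isSome with
  | true =>
    rw [hr] at hs
    rw [stateValue_cons_of_settled hp0 hp1 (.inl hs), stateValue, hr]
    simp [Gr, Gy, Gw, Gz]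
  | false =>
    rw [hr] at hs
    have hy' : -1 ≤ recordSum (record h) := by omega
    have hγ : γ = followSignal := by
      simp only [γ, patientProfile, if_neg hy]
      exact if_pos (settledCount_lt hs)
    rw [stateValue, recordSum_cons_of_not_settled hs hy', settledCount_cons_of_not_settled hs hy',
      record_cons_of_not_settled hs hy', Function.update_self]
    simp [hγ, Gr, Gy, Gw, Gz, actionSignal]

lemma buyReward_le_turnValue (hp0 : 0 < p) (hp1 : p < 1 / 2) {h : Past N} {n : Fin N}
    (hn : bought h n = false) (x : ℤˣ) :
    buyReward p (privateExp (record h) n x) ≤ turnValue p h n x n := by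
  obtain ⟨h1, h2⟩ := state_admissible hn
  have := actValue_optimal hp0 hp1 x _ (recordSum (record h)) _ h1 h2
  rw [turnValue, if_pos rfl, actValue, privateExp_eq hn]
  split_ifs with hc
  · exact le_rfl
  · exact this.2 (by simpa using hc)

lemma stateValue_le_turnValue (hp0 : 0 < p) (hp1 : p < 1 / 2) {h : Past N} {n : Fin N}
    (hn : bought h n = false) (x : ℤˣ) :
    stateValue p ((n, false) :: h) n x ≤ turnValue p h n x n := by
  obtain ⟨h1, h2⟩ := state_admissible hn
  have := actValue_optimal hp0 hp1 x _ (recordSum (record h)) _ h1 h2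
  rw [turnValue, if_pos rfl, actValue, stateValue_cons_self hp0 hp1 hn]
  split_ifs with hc
  · exact this.1 hc
  · exact le_rfl

lemma prescribed_of_not_bought {h : Past N} {n : Fin N} (hn : bought h n = false) :
    prescribed h n =
      patientProfile N (record h n).isSome (recordSum (record h)) (settledCount (record h) h) := by
  rw [prescribed, hn, if_neg Bool.false_ne_true]

/-- The prescribed action attains the value of the turn. -/
lemma turnValue_self_eq (hp0 : 0 < p) (hp1 : p < 1 / 2) {h : Past N} {n : Fin N}
    (hn : bought h n = false) (x : ℤˣ) :
    turnValue p h n x n = if prescribed h n x then buyReward p (privateExp (record h) n x)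
      else stateValue p ((n, false) :: h) n x := by
  rw [turnValue, if_pos rfl, actValue, stateValue_cons_self hp0 hp1 hn, privateExp_eq hn,
    prescribed_of_not_bought hn]

lemma turnValue_nonneg (hp0 : 0 < p) (hp1 : p < 1 / 2) {h : Past N} {n : Fin N}
    (hn : bought h n = false) (x : ℤˣ) (m : Fin N) : 0 ≤ turnValue p h n x m := by
  by_cases hmn : m = n
  · subst hmn
    exact (exAnte_nonneg hp0 hp1 _ _ _ _).trans (stateValue_le_turnValue hp0 hp1 hn x)
  · rw [← sum_observeProb_mul_stateValue hp0 hp1 hmn hn]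
    exact Finset.sum_nonneg fun a _ =>
      mul_nonneg (observeProb_nonneg hp0 hp1 _ _ _ _ _) (exAnte_nonneg hp0 hp1 _ _ _ _)

/-! ### Dynamic programming -/

/-- The expected reward of player `n` with signal `x` over the next `K` turns under her private
belief. -/
noncomputable def horizonReward (p : ℝ) (σ : Fin N → Strategy N) (n : Fin N) (x : ℤˣ) (K : ℕ)
    (h : Past N) (m : Fin N) : ℝ :=
  ∑ e, privateCond p (record h) n x e *
    (((e.2 : ℤ) : ℝ) * expPurchases σ n (combine n x e.1) K h m)

lemma expPurchases_of_bought {σ : Fin N → Strategy N} {n : Fin N} (hσ : Feasible n (σ n))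
    (x : Fin N → ℤˣ) (K : ℕ) {h : Past N} (hn : bought h n = true) (m : Fin N) :
    expPurchases σ n x K h m = 0 := by
  induction K generalizing h m with
  | zero => rfl
  | succ K ih =>
    have h1 : σ n (x n) h m = false := by
      by_contra hc
      have := (hσ _ _ _ (by simpa using hc)).2
      rw [hn] at this; cases this
    simp [expPurchases, h1, ind,
      ih (h := (m, σ m (x m) h m) :: h) (by rw [bought_cons, hn, Bool.or_true])]

lemma horizonReward_of_bought {σ : Fin N → Strategy N} {n : Fin N} (hσ : Feasible n (σ n))
    (x : ℤˣ) (K : ℕ) {h : Past N} (hn : bought h n = true) (m : Fin N) :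
    horizonReward p σ n x K h m = 0 := by
  simp [horizonReward, expPurchases_of_bought hσ _ K hn]

/-- The turn of another player who follows the patient profile. -/
lemma horizonReward_succ_of_ne (hp0 : 0 < p) (hp1 : p < 1 / 2) {σ : Fin N → Strategy N}
    {n : Fin N} (hσ : Feasible n (σ n)) {m : Fin N} (hmn : m ≠ n) {h : Past N}
    (hm : ∀ k, σ m k h m = prescribed h m k) (x : ℤˣ) (K : ℕ) :
    horizonReward p σ n x (K + 1) h m = ∑ a, observeProb p n x h m a *
      ((1 / N) * ∑ j, horizonReward p σ n x K ((m, a) :: h) j) := by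
  have h1 : ∀ k, σ n k h m = false := fun k => by
    by_contra hc
    exact hmn (hσ _ _ _ (by simpa using hc)).1
  set g : OthersSignals N n × ℤˣ → Bool → ℝ := fun e a =>
    ((e.2 : ℤ) : ℝ) * ((1 / N) * ∑ j, expPurchases σ n (combine n x e.1) K ((m, a) :: h) j) with hg
  have h2 : ∀ e, privateCond p (record h) n x e *
      (((e.2 : ℤ) : ℝ) * expPurchases σ n (combine n x e.1) (K + 1) h m) =
      ∑ a, observeProb p n x h m a * (privateCond p (record ((m, a) :: h)) n x e * g e a) := by
    intro e
    simp only [← mul_assoc (observeProb p n x h m _), ← observe_mul hp0 hp1]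
    simp only [ite_mul, zero_mul, Finset.sum_ite_eq, Finset.mem_univ, if_true]
    rw [expPurchases, h1, hm, hg]
    simp [ind]
  rw [horizonReward, Finset.sum_congr rfl fun e _ => h2 e, Finset.sum_comm]
  refine Finset.sum_congr rfl fun a _ => ?_
  rw [← Finset.mul_sum]
  congr 1
  simp only [horizonReward, hg]
  rw [Finset.sum_comm, Finset.mul_sum]
  refine Finset.sum_congr rfl fun e _ => ?_
  rw [← Finset.mul_sum, ← Finset.mul_sum]
  ring

lemma privateCond_cons_self (p : ℝ) (h : Past N) (n : Fin N) (a : Bool) (x : ℤˣ) :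
    privateCond p (record ((n, a) :: h)) n x = privateCond p (record h) n x := by
  rw [record]; split_ifs
  · exact privateCond_update_self _ _ _ _ _
  · rfl

/-- A turn in which player `n` waits. -/
lemma horizonReward_succ_of_wait {σ : Fin N → Strategy N} {n : Fin N} {h : Past N} {x : ℤˣ}
    (hx : σ n x h n = false) (K : ℕ) :
    horizonReward p σ n x (K + 1) h n =
      (1 / N) * ∑ j, horizonReward p σ n x K ((n, false) :: h) j := by
  simp only [horizonReward, expPurchases, combine_self, hx, privateCond_cons_self]
  rw [Finset.sum_comm, Finset.mul_sum]
  refine Finset.sum_congr rfl fun e _ => ?_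
  rw [← Finset.mul_sum, ← Finset.mul_sum]
  simp only [ind, Bool.false_eq_true, if_false]
  ring

/-- A turn in which player `n` buys. -/
lemma horizonReward_succ_of_buy (hp0 : 0 < p) (hp1 : p < 1 / 2) {σ : Fin N → Strategy N}
    {n : Fin N} (hσ : Feasible n (σ n)) {h : Past N} {x : ℤˣ} (hx : σ n x h n = true) (K : ℕ) :
    horizonReward p σ n x (K + 1) h n = buyReward p (privateExp (record h) n x) := by
  have hb : bought ((n, true) :: h) n = true := by simp [bought_cons]
  rw [← sum_privateCond_value hp0 hp1, horizonReward]
  simp [expPurchases, combine_self, hx, ind, expPurchases_of_bought hσ _ K hb]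

/-- The profile `σ` in which the players other than `n` follow the patient profile. -/
def FollowsExcept (σ : Fin N → Strategy N) (n : Fin N) : Prop :=
  ∀ m, m ≠ n → ∀ k h, σ m k h m = prescribed h m k

lemma bought_cons_of_ne {h : Past N} {m n : Fin N} (hmn : m ≠ n) (a : Bool)
    (hn : bought h n = false) : bought ((m, a) :: h) n = false := by
  simp [bought_cons, hn, hmn]

/-- No strategy of player `n` yields more than the value functions of the fixed-point equation. -/
lemma horizonReward_le (hp0 : 0 < p) (hp1 : p < 1 / 2) {σ : Fin N → Strategy N} {n : Fin N}
    (hσ : Feasible n (σ n)) (hf : FollowsExcept σ n) (x : ℤˣ) (K : ℕ) {h : Past N}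
    (hn : bought h n = false) (m : Fin N) :
    horizonReward p σ n x K h m ≤ turnValue p h n x m := by
  induction K generalizing h m with
  | zero => simpa [horizonReward, expPurchases] using turnValue_nonneg hp0 hp1 hn x m
  | succ K ih =>
    have hN : (0 : ℝ) < N := Nat.cast_pos.2 n.pos
    have havg : ∀ h' : Past N, bought h' n = false →
        (1 / N) * ∑ j, horizonReward p σ n x K h' j ≤ stateValue p h' n x := by
      intro h' hn'
      have := Finset.sum_le_sum fun j (_ : j ∈ Finset.univ) => ih hn' j
      rw [sum_turnValue hp0 hp1 hn'] at this
      rw [one_div, inv_mul_le_iff₀ hN]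
      exact this
    by_cases hmn : m = n
    · subst hmn
      cases hx : σ m x h m with
      | true =>
        rw [horizonReward_succ_of_buy hp0 hp1 hσ hx]
        exact buyReward_le_turnValue hp0 hp1 hn x
      | false =>
        rw [horizonReward_succ_of_wait hx]
        exact (havg _ (by simp [bought_cons, hn])).trans (stateValue_le_turnValue hp0 hp1 hn x)
    · rw [horizonReward_succ_of_ne hp0 hp1 hσ hmn (fun k => hf m hmn k h),
        ← sum_observeProb_mul_stateValue hp0 hp1 hmn hn]
      exact Finset.sum_le_sum fun a _ => mul_le_mul_of_nonneg_left
        (havg _ (bought_cons_of_ne hmn a hn)) (observeProb_nonneg hp0 hp1 _ _ _ _ _)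

/-- The states in which a player with signal `x` who has not bought will never buy. -/
def Stopped (h : Past N) (x : ℤˣ) : Prop :=
  recordSum (record h) ≤ -2 ∨
    (settledCount (record h) h = N ∧ recordSum (record h) ≤ 0 ∧ x = -1)

open Classical in
/-- A bound for the part of the value that a player following the patient profile has not yet
collected after `K` turns.  Each settled player halves it, and within a turn such progress has
probability at least `1 / N`. -/
noncomputable def deficitBound (h : Past N) (x : ℤˣ) (K : ℕ) : ℝ :=
  if Stopped h x then 0 else 2 ^ (N - settledCount (record h) h) * (1 - 1 / (2 * N)) ^ K

lemma rate_nonneg : (0 : ℝ) ≤ 1 - 1 / (2 * N) := by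
  rcases Nat.eq_zero_or_pos N with rfl | hN
  · simp
  · have hN : (1 : ℝ) ≤ N := Nat.one_le_cast.2 hN
    rw [sub_nonneg, div_le_one (by positivity)]; linarith

lemma deficitBound_nonneg (h : Past N) (x : ℤˣ) (K : ℕ) : 0 ≤ deficitBound h x K := by
  have := rate_nonneg (N := N)
  unfold deficitBound; split_ifs <;> positivity

lemma deficitBound_succ (h : Past N) (x : ℤˣ) (K : ℕ) :
    deficitBound h x (K + 1) = (1 - 1 / (2 * N)) * deficitBound h x K := by
  unfold deficitBound; split_ifs
  · simp
  · ring

lemma deficitBound_cons_of_settled {h : Past N} {m : Fin N}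
    (hm : settled (record h) h m = true ∨ recordSum (record h) ≤ -2) (a : Bool) (x : ℤˣ) (K : ℕ) :
    deficitBound ((m, a) :: h) x K = deficitBound h x K := by
  unfold deficitBound Stopped
  have hr := record_cons_of_settled hm a
  rw [hr]
  rcases hm with hm' | hm'
  · have := settledCount_cons_of_settled hm' a
    rw [hr] at this
    rw [this]
  · rw [if_pos (.inl hm'), if_pos (.inl hm')]

lemma deficitBound_cons_of_not_settled {h : Past N} {m : Fin N}
    (hm : settled (record h) h m = false) (hy : -1 ≤ recordSum (record h)) (a : Bool) (x : ℤˣ)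
    (K : ℕ) : deficitBound ((m, a) :: h) x K ≤ deficitBound h x K / 2 := by
  have hw := settledCount_lt hm
  have h0 : ¬ Stopped h x := by
    rintro (h1 | h1) <;> omega
  rw [deficitBound, deficitBound, if_neg h0]
  have hr := rate_nonneg (N := N)
  split_ifs
  · positivity
  · rw [settledCount_cons_of_not_settled hm hy]
    obtain ⟨d, hd⟩ : ∃ d, N - settledCount (record h) h = d + 1 :=
      ⟨N - settledCount (record h) h - 1, by omega⟩
    rw [show N - (settledCount (record h) h + 1) = d by omega, hd, pow_succ]
    linarith

lemma deficitBound_cons_le (h : Past N) (m : Fin N) (a : Bool) (x : ℤˣ) (K : ℕ) :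
    deficitBound ((m, a) :: h) x K ≤ deficitBound h x K := by
  by_cases hc : settled (record h) h m = true ∨ recordSum (record h) ≤ -2
  · exact (deficitBound_cons_of_settled hc a x K).le
  · rw [not_or, Bool.not_eq_true] at hc
    have := deficitBound_nonneg h x K
    exact (deficitBound_cons_of_not_settled hc.1 (by omega) a x K).trans (by linarith)

lemma stateValue_le_deficitBound (hp0 : 0 < p) (hp1 : p < 1 / 2) {h : Past N} {n : Fin N}
    (hn : bought h n = false) (x : ℤˣ) : stateValue p h n x ≤ deficitBound h x 0 := by
  unfold deficitBound
  split_ifs with hs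
  · rcases hs with hy | ⟨hw, hy, rfl⟩
    · exact (exAnte_of_le hp0 hp1 _ _ hy _).le
    · have hr : (record h n).isSome = true := by
        rw [← settled_of_not_bought hn]
        by_contra hc
        have := settledCount_lt (by simpa using hc : settled (record h) h n = false)
        omega
      rw [stateValue, hr, hw, exAnte, if_pos rfl, Nat.sub_self, revealedValue]
      exact max_le (buyReward_nonpos hp0 hp1 (by simpa using hy)) le_rfl
  · rw [pow_zero, mul_one]
    exact (exAnte_le_one hp0 hp1 _ _ _ _).trans (one_le_pow₀ one_le_two)

/-- In a state that is not stopped, some acting player makes progress: she is unsettled and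
reveals her signal, or she is the player herself and buys. -/
lemma exists_progress {h : Past N} {n : Fin N} (hn : bought h n = false) {x : ℤˣ}
    (hs : ¬ Stopped h x) :
    ∃ m, (settled (record h) h m = false ∧ -1 ≤ recordSum (record h)) ∨
      (m = n ∧ prescribed h n x = true) := by
  have hy : -1 ≤ recordSum (record h) := by
    by_contra hc
    exact hs (.inl (by omega))
  by_cases hw : settledCount (record h) h < N
  · obtain ⟨m, hm⟩ := exists_not_settled hw
    exact ⟨m, .inl ⟨hm, hy⟩⟩
  · refine ⟨n, .inr ⟨rfl, ?_⟩⟩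
    have hr : (record h n).isSome = true := by
      rw [← settled_of_not_bought hn]
      by_contra hc
      exact hw (settledCount_lt (by simpa using hc))
    have hw' : settledCount (record h) h = N := le_antisymm (settledCount_le _ _) (by omega)
    rw [prescribed_of_not_bought hn, patientProfile, if_neg (by omega), if_neg hw, hr]
    split_ifs with h1
    · rfl
    · simp only [true_and, not_le] at h1
      rcases Int.units_eq_one_or x with rfl | rfl
      · rfl
      · exact absurd (.inr ⟨hw', by omega, rfl⟩) hs

/-- If the deficit before the draw is at most `deficitBound h' x K` after each continuation `h'`,
then so it is in every turn. -/
lemma turnValue_sub_le (hp0 : 0 < p) (hp1 : p < 1 / 2) {σ : Fin N → Strategy N} {n : Fin N}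
    (hσ : Feasible n (σ n)) (hf : ∀ m k h, σ m k h m = prescribed h m k) {x : ℤˣ} {K : ℕ}
    (ih : ∀ h : Past N, bought h n = false →
      stateValue p h n x - (1 / N) * ∑ j, horizonReward p σ n x K h j ≤ deficitBound h x K)
    {h : Past N} (hn : bought h n = false) (m : Fin N) {C : ℝ} (hC0 : 0 ≤ C)
    (hC : m = n ∧ prescribed h n x = true ∨ ∀ a, deficitBound ((m, a) :: h) x K ≤ C) :
    turnValue p h n x m - horizonReward p σ n x (K + 1) h m ≤ C := by
  by_cases hmn : m = n
  · subst hmn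
    rw [turnValue_self_eq hp0 hp1 hn]
    cases hx : prescribed h m x with
    | true =>
      rw [horizonReward_succ_of_buy hp0 hp1 hσ ((hf m x h).trans hx), if_pos rfl, sub_self]
      exact hC0
    | false =>
      rw [horizonReward_succ_of_wait ((hf m x h).trans hx), if_neg Bool.false_ne_true]
      refine (ih _ (by simp [bought_cons, hn])).trans ?_
      rcases hC with hC | hC
      · rw [hC.2] at hx; cases hx
      · exact hC _
  · have hC : ∀ a, deficitBound ((m, a) :: h) x K ≤ C := hC.resolve_left fun hc => hmn hc.1
    rw [horizonReward_succ_of_ne hp0 hp1 hσ hmn (fun k => hf m k h),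
      ← sum_observeProb_mul_stateValue hp0 hp1 hmn hn, ← Finset.sum_sub_distrib]
    calc _ ≤ ∑ a, observeProb p n x h m a * C := Finset.sum_le_sum fun a _ => by
            rw [← mul_sub]
            exact mul_le_mul_of_nonneg_left
              ((ih _ (bought_cons_of_ne hmn a hn)).trans (hC a))
              (observeProb_nonneg hp0 hp1 _ _ _ _ _)
      _ = C := by rw [← Finset.sum_mul, sum_observeProb hp0 hp1, one_mul]

/-- The patient profile collects its value up to a geometrically decreasing deficit. -/
lemma stateValue_sub_le (hp0 : 0 < p) (hp1 : p < 1 / 2) {σ : Fin N → Strategy N} {n : Fin N}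
    (hσ : Feasible n (σ n)) (hf : ∀ m k h, σ m k h m = prescribed h m k) (x : ℤˣ) (K : ℕ)
    {h : Past N} (hn : bought h n = false) :
    stateValue p h n x - (1 / N) * ∑ j, horizonReward p σ n x K h j ≤ deficitBound h x K := by
  have hN : (0 : ℝ) < N := Nat.cast_pos.2 n.pos
  induction K generalizing h with
  | zero => simpa [horizonReward, expPurchases] using stateValue_le_deficitBound hp0 hp1 hn x
  | succ K ih =>
    set B := deficitBound h x K with hB
    have hB0 : 0 ≤ B := deficitBound_nonneg h x K
    have hall : ∀ m, turnValue p h n x m - horizonReward p σ n x (K + 1) h m ≤ B := fun m =>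
      turnValue_sub_le hp0 hp1 hσ hf (fun h => ih) hn m hB0
        (.inr fun a => deficitBound_cons_le h m a x K)
    -- One of the `N` equally likely turns halves the bound, hence the factor `1 - 1 / (2 N)`.
    obtain ⟨m, hm⟩ : ∃ m, turnValue p h n x m - horizonReward p σ n x (K + 1) h m ≤ B / 2 := by
      by_cases hs : Stopped h x
      · have : B = 0 := by rw [hB, deficitBound, if_pos hs]
        exact ⟨n, (hall n).trans (by rw [this]; norm_num)⟩
      · obtain ⟨m, hm⟩ := exists_progress hn hs
        refine ⟨m, turnValue_sub_le hp0 hp1 hσ hf (fun h => ih) hn m (by positivity) ?_⟩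
        rcases hm with hm | hm
        · exact .inr fun a => deficitBound_cons_of_not_settled hm.1 hm.2 a x K
        · exact .inl hm
    have hsum : ∑ j, (turnValue p h n x j - horizonReward p σ n x (K + 1) h j) ≤ N * B - B / 2 := by
      rw [← Finset.add_sum_erase _ _ (Finset.mem_univ m)]
      have h2 := Finset.sum_le_card_nsmul (Finset.univ.erase m)
        (fun j => turnValue p h n x j - horizonReward p σ n x (K + 1) h j) B fun j _ => hall j
      rw [Finset.card_erase_of_mem (Finset.mem_univ m), Finset.card_univ, Fintype.card_fin,
        nsmul_eq_mul, Nat.cast_pred n.pos] at h2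
      linarith
    rw [Finset.sum_sub_distrib, sum_turnValue hp0 hp1 hn] at hsum
    rw [deficitBound_succ, ← hB]
    have e1 : (N : ℝ) * (stateValue p h n x - 1 / N * ∑ j, horizonReward p σ n x (K + 1) h j) =
        N * stateValue p h n x - ∑ j, horizonReward p σ n x (K + 1) h j := by
      field_simp
    have e2 : (N : ℝ) * ((1 - 1 / (2 * N)) * B) = N * B - B / 2 := by
      field_simp
    exact le_of_mul_le_mul_left (by rw [e1, e2]; exact hsum) hN

/-- Following the patient profile yields at least the value of the turn. -/
lemma turnValue_le_rewardToGo [NeZero N] (hp0 : 0 < p) (hp1 : p < 1 / 2) {σ : Fin N → Strategy N}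
    {n : Fin N} (hσ : Feasible n (σ n)) (hf : ∀ m k h, σ m k h m = prescribed h m k) (x : ℤˣ)
    {h : Past N} (hn : bought h n = false) (m : Fin N) :
    turnValue p h n x m ≤ rewardToGo 1 σ n (privateCond p (record h) n x) x h m := by
  have hlim := tendsto_rewardToGo hσ (privateCond p (record h) n x) x h m
  have hrate : (1 : ℝ) - 1 / (2 * N) < 1 := by
    have hN : (0 : ℝ) < N := Nat.cast_pos.2 n.pos
    have : (0 : ℝ) < 1 / (2 * N) := by positivity
    linarith
  have hB : Filter.Tendsto (fun K => deficitBound h x K) Filter.atTop (nhds 0) := by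
    unfold deficitBound
    split_ifs
    · exact tendsto_const_nhds
    · simpa using (tendsto_pow_atTop_nhds_zero_of_lt_one rate_nonneg hrate).const_mul
        ((2 : ℝ) ^ (N - settledCount (record h) h))
  have hlim' := ((Filter.tendsto_add_atTop_iff_nat 1).2 hlim).add hB
  rw [add_zero] at hlim'
  refine ge_of_tendsto' hlim' fun K => ?_
  have := turnValue_sub_le hp0 hp1 hσ hf (K := K)
    (fun h hn => stateValue_sub_le hp0 hp1 hσ hf x K hn) hn m (deficitBound_nonneg h x K)
    (.inr fun a => deficitBound_cons_le h m a x K)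
  unfold horizonReward at this
  linarith

/-! ### The structured equilibrium -/

lemma feasible_forwardStrategy (hp0 : 0 < p) (hp1 : p < 1 / 2) (n : Fin N) :
    Feasible n (forwardStrategy p (toPolicy N (patientProfile N)) n) := by
  intro x h m hx
  rw [forwardStrategy_eq hp0 hp1] at hx
  split_ifs at hx with hmn
  refine ⟨hmn, ?_⟩
  by_contra hb
  rw [prescribed, if_pos (by simpa using hb)] at hx
  cases hx

lemma actionProb_forwardStrategy (hp0 : 0 < p) (hp1 : p < 1 / 2) (n : Fin N) (x : ℤˣ)
    (h : Past N) (m : Fin N) (a : Bool) :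
    actionProb (forwardStrategy p (toPolicy N (patientProfile N))) n
      (privateCond p (record h) n x) x h m a = observeProb p n x h m a := by
  simp only [actionProb, forwardStrategy_eq hp0 hp1, if_true, observeProb]

theorem isSPBE_patientProfile [NeZero N] (hp0 : 0 < p) (hp1 : p < 1 / 2) :
    IsSPBE p 1 (toPolicy N (patientProfile N)) where
  feasible := feasible_forwardStrategy hp0 hp1
  belief_nonneg n xn h m _ e := by
    rw [forwardBelief_eq hp0 hp1]; exact privateCond_nonneg hp0 hp1 _ _ _ _
  belief_sum n xn h m _ := by
    rw [forwardBelief_eq hp0 hp1]; exact sum_privateCond hp0 hp1 _ _ _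
  initial n xn m e := by
    have hprior : ∀ e : OthersSignals N n × ℤˣ, prior p (combine n xn e.1) e.2 =
        1 / 2 * privateWeight p (record ([] : Past N)) n xn e := by
      intro e
      rw [prior, Fintype.prod_eq_mul_prod_subtype_ne _ n, combine_self, privateWeight]
      simp only [combine_other]
      simp [record, likelihood]
    rw [forwardBelief_eq hp0 hp1]
    simp only [hprior]
    rw [← Finset.mul_sum, sum_privateWeight, privateCond, mul_div_mul_left _ _ (by norm_num)]
  bayes n xn h m a m' _ hpos e := by
    simp only [forwardBelief_eq hp0 hp1, actionProb_forwardStrategy hp0 hp1] at hpos ⊢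
    rw [eq_div_iff hpos.ne', mul_comm, ← observe_mul hp0 hp1]
    simp only [forwardStrategy_eq hp0 hp1, if_true]
  rational n xn h m _ s' hs' := by
    set s := forwardStrategy p (toPolicy N (patientProfile N)) with hs
    have hf : ∀ m k h, s m k h m = prescribed h m k := fun m k h => by
      rw [hs, forwardStrategy_eq hp0 hp1, if_pos rfl]
    have hsn : Feasible n (s n) := feasible_forwardStrategy hp0 hp1 n
    have hs'n : Feasible n (Function.update s n s' n) := by rwa [Function.update_self]
    rw [forwardBelief_eq hp0 hp1]
    have lim := tendsto_rewardToGo hsn (privateCond p (record h) n xn) xn h m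
    have lim' := tendsto_rewardToGo hs'n (privateCond p (record h) n xn) xn h m
    cases hn : bought h n with
    | true =>
      refine le_of_tendsto_of_tendsto' lim' lim fun K => le_of_eq ?_
      exact (horizonReward_of_bought hs'n xn K hn m).trans
        (horizonReward_of_bought hsn xn K hn m).symm
    | false =>
      refine (le_of_tendsto' lim' fun K => ?_).trans
        (turnValue_le_rewardToGo hp0 hp1 hsn hf xn hn m)
      refine horizonReward_le hp0 hp1 hs'n (fun i hi k h' => ?_) xn K hn m
      rw [Function.update_of_ne hi, hf]

/-- A player who has neither revealed nor bought is not counted in `w`, so `w < N` and she does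
not play `alwaysBuy`. -/
theorem partialOf_ne_alwaysBuy (hp0 : 0 < p) (hp1 : p < 1 / 2) {h : Past N} {m : Fin N}
    (hu : Unrevealed p (toPolicy N (patientProfile N)) h m) :
    partialOf (forwardStrategy p (toPolicy N (patientProfile N))) h m ≠ alwaysBuy := by
  obtain ⟨hb, hr⟩ := hu
  rw [commonBelief_eq hp0 hp1, revealed_condBelief hp0 hp1] at hr
  have hs : settled (record h) h m = false := by
    rw [settled_of_not_bought hb, ← Bool.not_eq_true, ← shown_ne_zero_iff, not_not, hr]
  have he : partialOf (forwardStrategy p (toPolicy N (patientProfile N))) h m =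
      prescribed h m := by
    funext x
    rw [partialOf, forwardStrategy_eq hp0 hp1, if_pos rfl]
  rw [he]
  by_cases hy : -1 ≤ recordSum (record h)
  · rw [prescribed_eq_followSignal hs hy]; exact followSignal_ne_alwaysBuy
  · rw [prescribed_eq_neverBuy hy]; decide

end Cascade

theorem mainTheorem2 (N : ℕ) [NeZero N] (p : ℝ) (hp0 : 0 < p) (hp1 : p < 1 / 2) :
    Cascade.SolvesFPE N p 1 (Cascade.patientProfile N) ∧
    Cascade.IsSPBE p 1 (Cascade.toPolicy N (Cascade.patientProfile N)) ∧
    (∀ (h : Cascade.Past N) (m : Fin N), h.Valid →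
      Cascade.Unrevealed p (Cascade.toPolicy N (Cascade.patientProfile N)) h m →
      Cascade.partialOf
        (Cascade.forwardStrategy p (Cascade.toPolicy N (Cascade.patientProfile N))) h m ≠
          Cascade.alwaysBuy) ∧
    (∀ (h : Cascade.Past N) (m : Fin N), h.Valid →
      ¬ Cascade.IsBadCascade p (Cascade.toPolicy N (Cascade.patientProfile N)) (-1) h m) := by
  refine ⟨Cascade.solvesFPE_patientProfile (NeZero.ne N) hp0 hp1,
    Cascade.isSPBE_patientProfile hp0 hp1,
    fun h m _ hu => Cascade.partialOf_ne_alwaysBuy hp0 hp1 hu, ?_⟩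
  rintro h m - ⟨hu, h1 | h2⟩
  · exact absurd h1.1 (by decide)
  · exact Cascade.partialOf_ne_alwaysBuy hp0 hp1 hu h2.2
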